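/- A *network* $\mathcal N$ is a finite oriented multigraph $(\mathcal V,\mathcal E)$ with distinct origin $\mathsf O$ and destination $\mathsf D$, in which at least one path leads from $\mathsf O$ to $\mathsf D$ and every edge lies on such a path (paths visit no vertex twice). It is *series-parallel* if it is a single edge, or two series-parallel networks connected in series, or two series-parallel networks connected in parallel (isolated vertices are disregarded). A *routing game with unknown state* on $\mathcal N$ consists of capacities $\gamma_e\in(0,\infty]$; a finite state space $\mathcal T$ with a prior $\mu$; and, for every edge $e$ and state $\theta$, a continuous, strictly increasing cost function $c_e(\cdot,\theta):[0,\gamma_e)\to\mathbb R_+$, such that any two distinct states differ in the cost function of some edge. Let $\gamma$ be the smallest capacity of a cut. For a belief $p$ on $\mathcal T$ and a demand $d\in[0,\gamma)$, let $x^*(d,p)$ be the vector of edge loads of the Wardrop equilibrium for the expected costs $\sum_\theta p(\theta)c_e(\cdot,\theta)$. The state $\Theta$ has law $\mu$, and the demands $D^1,D^2,\dots$ are i.i.d. with law $F$ on $[0,\gamma)$, independent of $\Theta$. In period $t$ the loads are $x^t=x^*(D^t,\mu^t)$, where $\mu^t$ is the conditional law of $\Theta$ given $D^1,\dots,D^t$,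 the past loads $x^s$, $s<t$, and the past realized costs $c_e(x^s_e,\Theta)$ of the edges that were used, i.e. with $x^s_e>0$. Let $\mu^\infty=\lim_t\mu^t$, which exists almost surely. *Weak learning* holds if, almost surely, $x^*(d,\mu^\infty)=x^*(d,\delta_\Theta)$ for all $d\in[0,\gamma)$; *weak learning on the support* holds if, almost surely, this equality holds for all $d\in[0,\gamma)$ in the support of $F$. **Theorem.** If the network $\mathcal N$ is not series-parallel, then there exist capacities $\gamma_e$, a finite state space with a prior, and state-dependent cost functions with $\lim_{x\to\gamma_e}c_e(x,\theta)=+\infty$ for all $e\in\mathcal E$, $\theta\in\mathcal T$, such that for every demand distribution $F$ on $[0,\gamma)$ weak learning fails, and, unless $F$ is the point mass at $0$, even weak learning on the support fails. -/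

import Mathlib

open MeasureTheory ProbabilityTheory Filter
open scoped ENNReal Topology

noncomputable section

/-- An oriented multigraph with vertices `V`, edges `E` and a distinguished origin/destination
pair. -/
structure ODGraph (V E : Type*) where
  src : E → V
  tgt : E → V
  origin : V
  dest : V

namespace ODGraph

variable {V E : Type*} (N : ODGraph V E)

/-- The edges of the list, taken in order, lead from `v` to `u`. -/
def IsWalk : List E → V → V → Prop
  | [], v, u => v = u
  | e :: l, v, u => N.src e = v ∧ IsWalk l (N.tgt e) u

/-- A path from `v` to `u` is a walk from `v` to `u` that visits no vertex twice. -/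
def IsPath (l : List E) (v u : V) : Prop :=
  N.IsWalk l v u ∧ (v :: l.map N.tgt).Nodup

/-- The set of paths from the origin to the destination. -/
def ODPath : Type _ := {l : List E // N.IsPath l N.origin N.dest}

instance [Finite E] : Finite N.ODPath := by
  classical
  have := Fintype.ofFinite E
  refine Finite.of_injective
    (fun r : N.ODPath => (⟨r.1, (List.nodup_cons.1 r.2.2).2.of_map _⟩ : {l : List E // l.Nodup})) ?_
  intro r s h
  have h' := congrArg Subtype.val h
  exact Subtype.ext h'

instance [Finite E] : Fintype N.ODPath := Fintype.ofFinite _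

/-- The vertices incident to some edge of `A`. -/
def verts (A : Set E) : Set V := {v | ∃ e ∈ A, N.src e = v ∨ N.tgt e = v}

/-- `N.IsSPFrom A o d`: the edges of `A` form a series-parallel network with origin `o` and
destination `d`. It is a single edge, or two series-parallel networks with nothing in common but
the vertex `m` that is the destination of the first and the origin of the second, or two
edge-disjoint series-parallel networks with no common vertices but their common origin and
their common destination. -/
inductive IsSPFrom : Set E → V → V → Prop
  | single (e : E) (he : N.src e ≠ N.tgt e) : IsSPFrom {e} (N.src e) (N.tgt e)
  | series {A B : Set E} {o m d : V} (hA : IsSPFrom A o m) (hB : IsSPFrom B m d)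
      (hAB : N.verts A ∩ N.verts B = {m}) : IsSPFrom (A ∪ B) o d
  | parallel {A B : Set E} {o d : V} (hA : IsSPFrom A o d) (hB : IsSPFrom B o d)
      (hdisj : Disjoint A B) (hAB : N.verts A ∩ N.verts B = {o, d}) : IsSPFrom (A ∪ B) o d

/-- The network is series-parallel. -/
def IsSeriesParallel : Prop := N.IsSPFrom Set.univ N.origin N.dest

/-- A cut is a set of edges that meets every path from the origin to the destination. -/
def IsCut (C : Finset E) : Prop := ∀ r : N.ODPath, ∃ e ∈ r.1, e ∈ C

end ODGraph

/-- A network: the origin and the destination are distinct, some path joins them, and each edge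
is part of a path from the origin to the destination. -/
structure Network (V E : Type*) extends ODGraph V E where
  origin_ne_dest : origin ≠ dest
  exists_path : Nonempty toODGraph.ODPath
  edge_mem_path : ∀ e, ∃ r : toODGraph.ODPath, e ∈ r.1

/-- The interval `[0, γ)` of real numbers, for `γ ∈ [0, ∞]`. -/
def Rco (γ : ℝ≥0∞) : Set ℝ := {x | 0 ≤ x ∧ ENNReal.ofReal x < γ}

/-- A routing game with unknown network state, on the network `N` and with finite state space `T`:
edge capacities in `(0, ∞]`, a state-dependent cost function on `[0, γ_e)` for each edge `e`
(continuous, strictly increasing, nonnegative), and a prior on the states. Distinct states are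
distinguished by the cost function of some edge. -/
structure RoutingGame {V E : Type*} (N : Network V E) (T : Type*) [MeasurableSpace T] where
  capacity : E → ℝ≥0∞
  capacity_pos : ∀ e, 0 < capacity e
  cost : E → T → ℝ → ℝ
  cost_nonneg : ∀ e θ, ∀ x ∈ Rco (capacity e), 0 ≤ cost e θ x
  cost_continuousOn : ∀ e θ, ContinuousOn (cost e θ) (Rco (capacity e))
  cost_strictMonoOn : ∀ e θ, StrictMonoOn (cost e θ) (Rco (capacity e))
  identifiable : ∀ θ θ', θ ≠ θ' → ∃ e, ∃ x ∈ Rco (capacity e), cost e θ x ≠ cost e θ' x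
  prior : Measure T
  [isProbabilityMeasure_prior : IsProbabilityMeasure prior]

/-- The (regular) conditional distribution under `P` of the random variable `X` given the
σ-algebra `m`. -/
def condLaw {Ω T : Type*} (m : MeasurableSpace Ω) [mΩ : MeasurableSpace Ω] [StandardBorelSpace Ω]
    [MeasurableSpace T] (P : Measure Ω) [IsFiniteMeasure P] (X : Ω → T) (ω : Ω) : Measure T :=
  (condExpKernel P m ω).map X

namespace RoutingGame

attribute [instance] RoutingGame.isProbabilityMeasure_prior

variable {V E : Type*} [Fintype E] {N : Network V E}
  {T : Type*} [Fintype T] [MeasurableSpace T] [DiscreteMeasurableSpace T]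
  (G : RoutingGame N T)

/-- For every edge `e` and every state, the cost of `e` tends to `+∞` as the load tends to the
capacity of `e`. -/
def HasUnboundedCosts : Prop :=
  ∀ e θ, ∀ M : ℝ, ∃ x₀ ∈ Rco (G.capacity e), ∀ x ∈ Rco (G.capacity e), x₀ ≤ x → M ≤ G.cost e θ x

/-- The capacity of the network: the smallest capacity of a cut. -/
def networkCapacity : ℝ≥0∞ := ⨅ (C : Finset E) (_ : N.IsCut C), ∑ e ∈ C, G.capacity e

open Classical in
/-- The load on the edge `e` induced by the path flows `y`. -/
def load (_ : RoutingGame N T) (y : N.ODPath → ℝ) (e : E) : ℝ :=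
  ∑ r : N.ODPath with e ∈ r.1, y r

/-- The flow `y` is feasible for the demand `d`. -/
def IsFeasible (d : ℝ) (y : N.ODPath → ℝ) : Prop :=
  (∀ r, 0 ≤ y r) ∧ ∑ r, y r = d ∧ ∀ e, ENNReal.ofReal (G.load y e) < G.capacity e

/-- The expected cost of an edge with load `x` under the belief `p`. -/
def expectedCost (p : Measure T) (e : E) (x : ℝ) : ℝ := ∫ θ, G.cost e θ x ∂p

open Classical in
/-- The expected cost of the path `r` when the flow is `y` and the belief is `p`. -/
def pathCost (p : Measure T) (y : N.ODPath → ℝ) (r : N.ODPath) : ℝ :=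
  ∑ e : E with e ∈ r.1, G.expectedCost p e (G.load y e)

/-- `y` is a Wardrop equilibrium for the belief `p` and the demand `d`. -/
def IsWardrop (p : Measure T) (d : ℝ) (y : N.ODPath → ℝ) : Prop :=
  G.IsFeasible d y ∧ ∀ r r', 0 < y r → G.pathCost p y r ≤ G.pathCost p y r'

open Classical in
/-- The Wardrop equilibrium load for the belief `p` and the demand `d`. As costs are strictly
increasing, all equilibrium flows induce the same load. The value is `0` where no equilibrium
exists. -/
def eqLoad (p : Measure T) (d : ℝ) : E → ℝ :=
  if h : ∃ y, G.IsWardrop p d y then G.load h.choose else 0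

/-- An outcome `ω` of the dynamic game: the sequence `ω.1` of the demands of the periods
`0, 1, 2, …` and the state `ω.2`. -/
abbrev Outcome (_ : RoutingGame N T) : Type _ := (ℕ → ℝ) × T

/-- The law of the outcome: demands are i.i.d. with law `F`, and independent of the state, whose
law is the prior. -/
abbrev law (F : Measure ℝ) : Measure G.Outcome :=
  (Measure.infinitePi fun _ : ℕ => F).prod G.prior

/-- What a period with loads `x` reveals when the state is `θ`: the load of every edge, and the
realized cost of every edge that is used (an entry `0` stands for an unused edge). -/
def observation (x : E → ℝ) (θ : T) (e : E) : ℝ × ℝ :=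
  open Classical in (x e, if 0 < x e then G.cost e θ (x e) else 0)

/-- The conditional distribution of the state given the σ-algebra `m`. -/
def condState (F : Measure ℝ) [IsProbabilityMeasure F] (m : MeasurableSpace G.Outcome)
    (ω : G.Outcome) : Measure T :=
  condLaw (mΩ := Prod.instMeasurableSpace) m (G.law F) Prod.snd ω

/-- The σ-algebra generated by the history at period `t`: the demands of the periods `0, …, t`,
and what the equilibria of the periods `0, …, t - 1` revealed. In each period the equilibrium is
played for the current demand and the current posterior belief. -/
@[reducible] def history (F : Measure ℝ) [IsProbabilityMeasure F] : ℕ → MeasurableSpace G.Outcome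
  | 0 => MeasurableSpace.comap (fun ω => ω.1 0) inferInstance
  | t + 1 =>
      history F t
      ⊔ MeasurableSpace.comap (fun ω =>
          G.observation (G.eqLoad (G.condState F (history F t) ω) (ω.1 t)) ω.2) inferInstance
      ⊔ MeasurableSpace.comap (fun ω => ω.1 (t + 1)) inferInstance

/-- The posterior belief at period `t`: the conditional distribution of the state given the
history. -/
def belief (F : Measure ℝ) [IsProbabilityMeasure F] (t : ℕ) (ω : G.Outcome) : Measure T :=
  G.condState F (G.history F t) ω

/-- `ν` is the limit of the posterior beliefs along the outcome `ω`. By martingale convergence it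
exists for almost every `ω`. -/
def IsLimitBelief (F : Measure ℝ) [IsProbabilityMeasure F] (ω : G.Outcome) (ν : Measure T) : Prop :=
  IsProbabilityMeasure ν ∧
    ∀ θ, Tendsto (fun t => (G.belief F t ω).real {θ}) atTop (𝓝 (ν.real {θ}))

/-- Almost surely, for every demand in `S`, the equilibrium load under the limit belief is the
equilibrium load under complete information. -/
def WeakLearningOn (F : Measure ℝ) [IsProbabilityMeasure F] (S : Set ℝ) : Prop :=
  ∀ᵐ ω ∂G.law F, ∀ ν, G.IsLimitBelief F ω ν →
    ∀ d ∈ S, G.eqLoad ν d = G.eqLoad (Measure.dirac ω.2) d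

/-- Weak learning: the equilibrium loads under the limit belief and under complete information
are the same functions of the demand `d ∈ [0, γ)`, almost surely. -/
def WeakLearning (F : Measure ℝ) [IsProbabilityMeasure F] : Prop :=
  G.WeakLearningOn F (Rco G.networkCapacity)

/-- Weak learning on the support: the two equilibrium loads are only required to be the same for
the demands in the support of the demand distribution. -/
def WeakLearningOnSupport (F : Measure ℝ) [IsProbabilityMeasure F] : Prop :=
  G.WeakLearningOn F (F.support ∩ Rco G.networkCapacity)

end RoutingGame

end

/-! The construction generalizes the Wheatstone network, where a link between two parallel routes is
worth using only if it is known to be cheap. A bridge consists of a real function β on the vertices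
and a walk from u to v ≠ u on which β is constant, such that u and v both lie on walks from the
origin to the destination along which β increases strictly.

Existence: `IsNet.isSPFrom_or_hasBridge` is an induction on the number of edges. A direct edge from
origin to destination splits off in parallel, and a vertex common to all routes splits the network
in series. Otherwise there are two routes without common inner vertices (Menger's theorem for two
paths). Either some route links two such disjoint routes, which yields a bridge, or the routes that
meet the first one are separated in parallel from the others.

Completion: in `HasBridge.exists_complete`, β is modified until each edge along which it increases
belongs to a strictly increasing walk from origin to destination. A bridge of minimal length and a
balancing fixed point achieve this.

The game (`exists_affineGame`): let S be the set of edges along which β increases, and spread the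
demand d uniformly over the paths in S, with loads d * x e. The costs on S are known, and affine, so
that for every d these loads come from the potential α + d β, where α = K β + 1_v. An edge outside S
costs its load plus 2 or 0, depending on the state, hence 1 on average at load zero. The potential
rises by at most 1 across it, so under the prior it stays unused for every demand, nothing is
revealed, and beliefs never move (`belief_ae_eq_prior`). In state 1 the bridge leads from u to v for
free, although the potential rises by 1 from u to v; as β u = β v, this gain does not depend on d.
Hence the loads d * x are not an equilibrium in state 1 for any d > 0. -/

namespace ODGraph

/-! ### Walks, paths and their vertices -/

section Walks

variable {V E : Type*} {N : ODGraph V E}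

theorem isWalk_append {l₁ l₂ : List E} {v u : V} :
    N.IsWalk (l₁ ++ l₂) v u ↔ ∃ x, N.IsWalk l₁ v x ∧ N.IsWalk l₂ x u := by
  induction l₁ generalizing v with
  | nil => simp [IsWalk]
  | cons e l ih =>
    simp only [List.cons_append, IsWalk, ih]
    constructor
    · rintro ⟨h, x, h1, h2⟩
      exact ⟨x, ⟨h, h1⟩, h2⟩
    · rintro ⟨x, ⟨h, h1⟩, h2⟩
      exact ⟨h, x, h1, h2⟩

theorem IsWalk.append {l₁ l₂ : List E} {v x u : V} (h₁ : N.IsWalk l₁ v x) (h₂ : N.IsWalk l₂ x u) :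
    N.IsWalk (l₁ ++ l₂) v u :=
  isWalk_append.2 ⟨x, h₁, h₂⟩

/-- The vertices visited by the walk `l` that starts at `v`. -/
def support (N : ODGraph V E) (v : V) (l : List E) : List V := v :: l.map N.tgt

theorem mem_support {v x : V} {l : List E} :
    x ∈ N.support v l ↔ x = v ∨ ∃ e ∈ l, N.tgt e = x := by
  simp [support]

theorem start_mem_support (v : V) (l : List E) : v ∈ N.support v l := by simp [support]

theorem tgt_mem_support {v : V} {l : List E} {e : E} (he : e ∈ l) : N.tgt e ∈ N.support v l :=
  mem_support.2 (Or.inr ⟨e, he, rfl⟩)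

theorem IsWalk.end_mem_support {l : List E} {v u : V} (h : N.IsWalk l v u) :
    u ∈ N.support v l := by
  induction l generalizing v with
  | nil => exact mem_support.2 (Or.inl h.symm)
  | cons e l ih =>
    have := ih h.2
    rw [mem_support] at this ⊢
    rcases this with h1 | ⟨f, hf, h1⟩
    · exact Or.inr ⟨e, by simp, h1.symm⟩
    · exact Or.inr ⟨f, by simp [hf], h1⟩

theorem IsWalk.src_mem_support {l : List E} {v u : V} (h : N.IsWalk l v u) {e : E} (he : e ∈ l) :
    N.src e ∈ N.support v l := by
  induction l generalizing v with
  | nil => simp at he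
  | cons f l ih =>
    rcases List.mem_cons.1 he with rfl | he
    · exact mem_support.2 (Or.inl h.1)
    · have := ih h.2 he
      rw [mem_support] at this ⊢
      rcases this with h1 | ⟨g, hg, h1⟩
      · exact Or.inr ⟨f, by simp, h1.symm⟩
      · exact Or.inr ⟨g, by simp [hg], h1⟩

/-- A vertex of a walk is its end or the source of one of its edges. -/
theorem IsWalk.mem_support_iff {l : List E} {v u x : V} (h : N.IsWalk l v u) :
    x ∈ N.support v l ↔ x = u ∨ ∃ e ∈ l, N.src e = x := by
  constructor
  · intro hx
    induction l generalizing v with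
    | nil => 
      rcases mem_support.1 hx with h1 | ⟨e, he, -⟩
      · exact Or.inl (h1.trans h)
      · simp at he
    | cons e l ih =>
      by_cases hxv : x = v
      · exact Or.inr ⟨e, by simp, h.1.trans hxv.symm⟩
      · have : x ∈ N.support (N.tgt e) l := by
          simpa [support, hxv] using hx
        rcases ih h.2 this with h1 | ⟨f, hf, h1⟩
        · exact Or.inl h1
        · exact Or.inr ⟨f, by simp [hf], h1⟩
  · rintro (rfl | ⟨e, he, rfl⟩)
    · exact h.end_mem_support
    · exact h.src_mem_support he

theorem support_append {l₁ l₂ : List E} {v y x : V} (h₁ : N.IsWalk l₁ v y) :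
    x ∈ N.support v (l₁ ++ l₂) ↔ x ∈ N.support v l₁ ∨ x ∈ N.support y l₂ := by
  constructor
  · intro h
    rcases mem_support.1 h with rfl | ⟨e, he, rfl⟩
    · exact Or.inl (start_mem_support _ _)
    · rcases List.mem_append.1 he with he | he
      · exact Or.inl (tgt_mem_support he)
      · exact Or.inr (tgt_mem_support he)
  · rintro (h | h)
    · rcases mem_support.1 h with rfl | ⟨e, he, rfl⟩
      · exact start_mem_support _ _
      · exact tgt_mem_support (by simp [he])
    · rcases mem_support.1 h with rfl | ⟨e, he, rfl⟩
      · have := h₁.end_mem_support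
        rcases mem_support.1 this with rfl | ⟨e, he, rfl⟩
        · exact start_mem_support _ _
        · exact tgt_mem_support (by simp [he])
      · exact tgt_mem_support (by simp [he])

theorem support_subset {l₁ l₂ : List E} {v : V} (h : l₁ ⊆ l₂) :
    N.support v l₁ ⊆ N.support v l₂ := by
  intro x hx
  rcases mem_support.1 hx with rfl | ⟨e, he, rfl⟩
  · exact start_mem_support _ _
  · exact tgt_mem_support (h he)

/-- A walk can be split at each of its vertices. -/
theorem IsWalk.exists_split {l : List E} {v u x : V} (h : N.IsWalk l v u)
    (hx : x ∈ N.support v l) : ∃ l₁ l₂, l = l₁ ++ l₂ ∧ N.IsWalk l₁ v x ∧ N.IsWalk l₂ x u := by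
  induction l generalizing v with
  | nil =>
    have : x = v := by simpa [support] using hx
    subst this
    exact ⟨[], [], rfl, rfl, h⟩
  | cons e l ih =>
    by_cases hxv : x = v
    · subst hxv
      exact ⟨[], e :: l, rfl, rfl, h⟩
    · have : x ∈ N.support (N.tgt e) l := by
        simpa [support, hxv] using hx
      obtain ⟨l₁, l₂, rfl, h1, h2⟩ := ih h.2 this
      exact ⟨e :: l₁, l₂, rfl, ⟨h.1, h1⟩, h2⟩

theorem IsPath.cons_iff {e : E} {l : List E} {v u : V} :
    N.IsPath (e :: l) v u ↔
      N.src e = v ∧ v ∉ N.support (N.tgt e) l ∧ N.IsPath l (N.tgt e) u := by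
  simp only [IsPath, IsWalk, List.map_cons, support, List.nodup_cons]
  tauto

/-- The two parts of a split path are paths that share nothing but the vertex of the split. -/
theorem IsPath.split {l₁ l₂ : List E} {v x u : V} (h : N.IsPath (l₁ ++ l₂) v u)
    (h₁ : N.IsWalk l₁ v x) :
    N.IsPath l₁ v x ∧ N.IsPath l₂ x u ∧
      ∀ y, y ∈ N.support v l₁ → y ∈ N.support x l₂ → y = x := by
  induction l₁ generalizing v with
  | nil =>
    have : v = x := h₁
    subst this
    exact ⟨⟨rfl, by simp⟩, h, fun y hy _ => by simpa [support] using hy⟩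
  | cons e l ih =>
    rw [List.cons_append, IsPath.cons_iff] at h
    obtain ⟨hp, hq, hd⟩ := ih h.2.2 h₁.2
    have hv : ∀ {y}, y ∈ N.support x l₂ → y ≠ v := by
      rintro y hy rfl
      exact h.2.1 ((support_append h₁.2).2 (Or.inr hy))
    refine ⟨IsPath.cons_iff.2 ⟨h.1, fun hc => h.2.1 ((support_append h₁.2).2 (Or.inl hc)), hp⟩, hq,
      fun y hy hy' => ?_⟩
    have : y ∈ N.support (N.tgt e) l := by
      have := hv hy'
      simpa [support, this] using hy
    exact hd y this hy'

/-- Every walk contains a path with the same ends. -/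
theorem IsWalk.exists_isPath {l : List E} {v u : V} (h : N.IsWalk l v u) :
    ∃ l', N.IsPath l' v u ∧ l'.Sublist l := by
  induction l generalizing v with
  | nil => exact ⟨[], ⟨h, by simp⟩, .refl _⟩
  | cons e l ih =>
    obtain ⟨l', hl', hs⟩ := ih h.2
    by_cases hv : v ∈ N.support (N.tgt e) l'
    · obtain ⟨l₁, l₂, rfl, h1, h2⟩ := hl'.1.exists_split hv
      exact ⟨l₂, (hl'.split h1).2.1, ((List.sublist_append_right l₁ l₂).trans hs).cons e⟩
    · exact ⟨e :: l', IsPath.cons_iff.2 ⟨h.1, hv, hl'⟩, hs.cons_cons e⟩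

theorem IsPath.nodup {l : List E} {v u : V} (h : N.IsPath l v u) : l.Nodup :=
  (List.nodup_cons.1 h.2).2.of_map _

theorem IsPath.tgt_ne_start {l : List E} {v u : V} (h : N.IsPath l v u) {e : E} (he : e ∈ l) :
    N.tgt e ≠ v := fun hc => (List.nodup_cons.1 h.2).1 (hc ▸ List.mem_map_of_mem he)

theorem IsPath.src_ne_end {l : List E} {v u : V} (h : N.IsPath l v u) {e : E} (he : e ∈ l) :
    N.src e ≠ u := by
  induction l generalizing v with
  | nil => simp at he
  | cons f l ih =>
    rw [IsPath.cons_iff] at h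
    rcases List.mem_cons.1 he with rfl | he
    · rintro rfl
      exact h.2.1 (h.1 ▸ h.2.2.1.end_mem_support)
    · exact ih h.2.2 he

/-- The first visit of a walk to a set of vertices. -/
theorem IsWalk.exists_first {l : List E} {v u : V} (h : N.IsWalk l v u) {X : Set V} (hu : u ∈ X) :
    ∃ l₁ l₂ x, l = l₁ ++ l₂ ∧ N.IsWalk l₁ v x ∧ N.IsWalk l₂ x u ∧ x ∈ X ∧
      ∀ e ∈ l₁, N.src e ∉ X := by
  induction l generalizing v with
  | nil => exact ⟨[], [], u, rfl, h, rfl, hu, by simp⟩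
  | cons e l ih =>
    by_cases hv : v ∈ X
    · exact ⟨[], e :: l, v, rfl, rfl, h, hv, by simp⟩
    · obtain ⟨l₁, l₂, x, rfl, h1, h2, hx, h3⟩ := ih h.2
      refine ⟨e :: l₁, l₂, x, rfl, ⟨h.1, h1⟩, h2, hx, fun f hf => ?_⟩
      rcases List.mem_cons.1 hf with rfl | hf
      · rwa [h.1]
      · exact h3 f hf

/-- The last visit of a walk to a set of vertices. -/
theorem IsWalk.exists_last {l : List E} {v u : V} (h : N.IsWalk l v u) {X : Set V}
    (hX : ∃ x ∈ N.support v l, x ∈ X) :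
    ∃ l₁ l₂ x, l = l₁ ++ l₂ ∧ N.IsWalk l₁ v x ∧ N.IsWalk l₂ x u ∧ x ∈ X ∧
      ∀ e ∈ l₂, N.tgt e ∉ X := by
  induction l generalizing v with
  | nil =>
    obtain ⟨x, hx, hxX⟩ := hX
    have : x = v := by simpa [support] using hx
    exact ⟨[], [], v, rfl, rfl, h, this ▸ hxX, by simp⟩
  | cons e l ih =>
    by_cases hl : ∃ x ∈ N.support (N.tgt e) l, x ∈ X
    · obtain ⟨l₁, l₂, x, rfl, h1, h2, hx, h3⟩ := ih h.2 hl
      exact ⟨e :: l₁, l₂, x, rfl, ⟨h.1, h1⟩, h2, hx, h3⟩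
    · push Not at hl
      obtain ⟨x, hx, hxX⟩ := hX
      rcases List.mem_cons.1 hx with rfl | hx
      · refine ⟨[], e :: l, x, rfl, rfl, h, hxX, fun f hf => hl _ ?_⟩
        exact List.mem_map_of_mem (f := N.tgt) hf
      · exact absurd hxX (hl x hx)

/-- The vertices of a walk, as a sequence. -/
theorem IsWalk.exists_seq {l : List E} {v u : V} (h : N.IsWalk l v u) :
    ∃ w : ℕ → V, w 0 = v ∧ w l.length = u ∧
      (∀ i < l.length, ∃ e ∈ l, N.src e = w i ∧ N.tgt e = w (i + 1)) ∧
      ∀ i ≤ l.length, w i ∈ N.support v l := by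
  induction l generalizing v with
  | nil =>
    refine ⟨fun _ => v, rfl, h, by simp, fun i _ => start_mem_support _ _⟩
  | cons e l ih =>
    obtain ⟨w, h0, h1, h2, h3⟩ := ih h.2
    refine ⟨fun i => Nat.casesOn i v w, rfl, h1, ?_, ?_⟩
    · rintro (_ | i) hi
      · exact ⟨e, by simp, h.1, h0.symm⟩
      · obtain ⟨f, hf, hs⟩ := h2 i (by simpa using hi)
        exact ⟨f, by simp [hf], hs⟩
    · rintro (_ | i) hi
      · exact start_mem_support _ _
      · have := h3 i (by simpa using hi)
        rcases mem_support.1 this with h4 | ⟨f, hf, h4⟩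
        · exact mem_support.2 (Or.inr ⟨e, by simp, h4.symm⟩)
        · exact mem_support.2 (Or.inr ⟨f, by simp [hf], h4⟩)

/-- A function that increases strictly along a path. -/
theorem IsPath.exists_height {l : List E} {v u : V} (h : N.IsPath l v u) :
    ∃ f : V → ℝ, f v = 0 ∧ (∀ x, x ≠ v → 0 < f x) ∧ ∀ e ∈ l, f (N.src e) < f (N.tgt e) := by
  classical
  induction l generalizing v with
  | nil => exact ⟨fun x => if x = v then 0 else 1, by simp, by simp +contextual, by simp⟩
  | cons e l ih =>
    rw [IsPath.cons_iff] at h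
    obtain ⟨f, h0, h1, h2⟩ := ih h.2.2
    have hf : ∀ x, 0 ≤ f x := fun x => by
      by_cases hx : x = N.tgt e
      · rw [hx, h0]
      · exact (h1 x hx).le
    refine ⟨fun x => if x = v then 0 else f x + 1, by simp, fun x hx => ?_, fun g hg => ?_⟩
    · simp only [hx, if_false]
      linarith [hf x]
    · rcases List.mem_cons.1 hg with rfl | hg
      · have : N.tgt g ≠ v := fun hc => h.2.1 (hc ▸ start_mem_support _ _)
        simp only [h.1, this, if_true, if_false]
        linarith [hf (N.tgt g)]
      · have h3 : N.tgt g ≠ v := fun hc => h.2.1 (hc ▸ tgt_mem_support hg)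
        have h4 : N.src g ≠ v := fun hc => h.2.1 (hc ▸ h.2.2.1.src_mem_support hg)
        simp only [h3, h4, if_false]
        linarith [h2 g hg]

end Walks

/-! ### Bridges, and Menger's theorem for two routes -/

section Bridges

variable {V E : Type*} {N : ODGraph V E}

/-- Some edge of `A` leads from `x` to `y`, and `β` increases strictly along it. -/
def Up (N : ODGraph V E) (A : Set E) (β : V → ℝ) (x y : V) : Prop :=
  ∃ e ∈ A, N.src e = x ∧ N.tgt e = y ∧ β x < β y

/-- `w 0, …, w k` is a walk in `A` along which `β` is constant, and both its ends lie on walks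
in `A` from `o` to `d` along which `β` increases strictly. -/
structure IsBridge (N : ODGraph V E) (A : Set E) (o d : V) (β : V → ℝ) (k : ℕ) (w : ℕ → V) :
    Prop where
  ne : w 0 ≠ w k
  step : ∀ i < k, ∃ e ∈ A, N.src e = w i ∧ N.tgt e = w (i + 1)
  level : ∀ i ≤ k, β (w i) = β (w 0)
  left_in : Relation.ReflTransGen (N.Up A β) o (w 0)
  left_out : Relation.ReflTransGen (N.Up A β) (w 0) d
  right_in : Relation.ReflTransGen (N.Up A β) o (w k)
  right_out : Relation.ReflTransGen (N.Up A β) (w k) d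

/-- The edges of `A` contain a bridge. -/
def HasBridge (N : ODGraph V E) (A : Set E) (o d : V) : Prop :=
  ∃ β k w, N.IsBridge A o d β k w

theorem Up.mono {A B : Set E} (h : A ⊆ B) {β : V → ℝ} {x y : V} (hu : N.Up A β x y) :
    N.Up B β x y := by
  obtain ⟨e, he, h'⟩ := hu
  exact ⟨e, h he, h'⟩

theorem HasBridge.mono {A B : Set E} (h : A ⊆ B) {o d : V} (hA : N.HasBridge A o d) :
    N.HasBridge B o d := by
  obtain ⟨β, k, w, hw⟩ := hA
  have hm {x y : V} : Relation.ReflTransGen (N.Up A β) x y → Relation.ReflTransGen (N.Up B β) x y :=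
    Relation.ReflTransGen.mono (fun _ _ => Up.mono h) _ _
  exact ⟨β, k, w, hw.ne, fun i hi => (hw.step i hi).imp fun e he => ⟨h he.1, he.2⟩, hw.level,
    hm hw.left_in, hm hw.left_out, hm hw.right_in, hm hw.right_out⟩

theorem IsWalk.reflTransGen_up {A : Set E} {β : V → ℝ} {l : List E} {v u : V}
    (h : N.IsWalk l v u) (hA : ∀ e ∈ l, e ∈ A) (hβ : ∀ e ∈ l, β (N.src e) < β (N.tgt e)) :
    Relation.ReflTransGen (N.Up A β) v u := by
  induction l generalizing v with
  | nil => exact h ▸ .refl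
  | cons e l ih =>
    refine .head ⟨e, hA e (by simp), h.1, rfl, ?_⟩
      (ih h.2 (fun f hf => hA f (by simp [hf])) (fun f hf => hβ f (by simp [hf])))
    have := hβ e (by simp)
    rwa [h.1] at this

/-- A route: a path from `o` to `d` with edges in `A`. -/
def IsRoute (N : ODGraph V E) (A : Set E) (o d : V) (l : List E) : Prop :=
  N.IsPath l o d ∧ ∀ e ∈ l, e ∈ A

/-- Each edge of the nonempty set `A` is part of a route from `o` to `d ≠ o`. -/
structure IsNet (N : ODGraph V E) (A : Set E) (o d : V) : Prop where
  ne : o ≠ d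
  nonempty : A.Nonempty
  mem_route : ∀ e ∈ A, ∃ l, N.IsRoute A o d l ∧ e ∈ l

/-- The inner vertices of a route. -/
def inner (N : ODGraph V E) (o d : V) (l : List E) : Set V :=
  {x | x ∈ N.support o l ∧ x ≠ o ∧ x ≠ d}

theorem IsWalk.exists_isRoute {A : Set E} {o d : V} {l : List E} (h : N.IsWalk l o d)
    (hA : ∀ e ∈ l, e ∈ A) : ∃ l', N.IsRoute A o d l' ∧ l' ⊆ l := by
  obtain ⟨l', h1, h2⟩ := h.exists_isPath
  exact ⟨l', ⟨h1, fun e he => hA e (h2.subset he)⟩, h2.subset⟩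

theorem IsRoute.mem_inner_of_mem {A : Set E} {o d : V} {l : List E} (hl : N.IsRoute A o d l)
    {e : E} (he : e ∈ l) (hne : ¬ (N.src e = o ∧ N.tgt e = d)) :
    ∃ x ∈ N.inner o d l, N.src e = x ∨ N.tgt e = x := by
  by_cases hs : N.src e = o
  · exact ⟨N.tgt e, ⟨tgt_mem_support he, hl.1.tgt_ne_start he, fun h => hne ⟨hs, h⟩⟩, Or.inr rfl⟩
  · exact ⟨N.src e, ⟨hl.1.1.src_mem_support he, hs, hl.1.src_ne_end he⟩, Or.inl rfl⟩

/-- If no vertex separates `o` from `d` and no edge joins them, there are two routes without common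
inner vertices. -/
theorem exists_disjoint_routes {A : Set E} {o d : V} (hod : o ≠ d)
    (hedge : ∀ e ∈ A, ¬ (N.src e = o ∧ N.tgt e = d)) (hroute : ∃ l, N.IsRoute A o d l)
    (hcut : ∀ m, m ≠ o → m ≠ d → ∃ l, N.IsRoute A o d l ∧ m ∉ N.support o l) :
    ∃ l₁ l₂, N.IsRoute A o d l₁ ∧ N.IsRoute A o d l₂ ∧
      Disjoint (N.inner o d l₁) (N.inner o d l₂) := by
  -- Induction on the length of the tail `T`. The invariant: `C₁` and `C₂` run from `o` to `y` and
  -- share only their ends, and the path `T` from `y` to `d` meets them only at `y`.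
  have key : ∀ (n : ℕ) (y : V) (C₁ C₂ T : List E), T.length = n → y ≠ o →
      N.IsWalk C₁ o y → N.IsWalk C₂ o y → N.IsPath T y d →
      (∀ e ∈ C₁, e ∈ A) → (∀ e ∈ C₂, e ∈ A) → (∀ e ∈ T, e ∈ A) →
      (∀ e ∈ C₁, N.src e ≠ y) → (∀ e ∈ C₂, N.src e ≠ y) →
      (∀ x ∈ N.support o C₁, x ∈ N.support o C₂ → x = o ∨ x = y) →
      (∀ x ∈ N.support y T, x ∈ N.support o C₁ ∨ x ∈ N.support o C₂ → x = y) →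
      ∃ l₁ l₂, N.IsRoute A o d l₁ ∧ N.IsRoute A o d l₂ ∧
        Disjoint (N.inner o d l₁) (N.inner o d l₂) := by
    intro n
    induction n using Nat.strong_induction_on with
    | _ n ih =>
    intro y C₁ C₂ T hn hyo hC₁ hC₂ hT hA₁ hA₂ hAT hy₁ hy₂ hCC hTC
    by_cases hyd : y = d
    · subst hyd
      obtain ⟨l₁, h1, s1⟩ := hC₁.exists_isRoute hA₁
      obtain ⟨l₂, h2, s2⟩ := hC₂.exists_isRoute hA₂
      refine ⟨l₁, l₂, h1, h2, Set.disjoint_left.2 fun x hx hx' => ?_⟩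
      rcases hCC x (support_subset s1 hx.1) (support_subset s2 hx'.1) with h | h
      · exact hx.2.1 h
      · exact hx.2.2 h
    -- A route that avoids `y` is followed to its first vertex `w` on `T`; `R` is its piece from the
    -- last contact `z` with `C₁` or `C₂` to `w`. Then `w` takes the role of `y`, and the tail
    -- becomes shorter.
    obtain ⟨ρ, hρ, hyρ⟩ := hcut y hyo hyd
    obtain ⟨ρ₁, ρ₂, w, rfl, hρ₁, -, hwT, hρ₁T⟩ :=
      hρ.1.1.exists_first (X := {x | x ∈ N.support y T}) hT.1.end_mem_support
    have hyρ₁ : y ∉ N.support o ρ₁ := fun hc => hyρ ((support_append hρ₁).2 (Or.inl hc))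
    obtain ⟨R₀, R, z, rfl, hR₀, hR, hzC, hRC⟩ :=
      hρ₁.exists_last (X := {x | x ∈ N.support o C₁ ∨ x ∈ N.support o C₂})
        ⟨o, start_mem_support _ _, Or.inl (start_mem_support _ _)⟩
    have hzy : z ≠ y := fun hc =>
      hyρ₁ ((support_append hR₀).2 (Or.inl (hc ▸ hR₀.end_mem_support)))
    have hwy : w ≠ y := fun hc => hyρ₁ (hc ▸ hρ₁.end_mem_support)
    have hRA : ∀ e ∈ R, e ∈ A := fun e he => hρ.2 e (by simp [he])
    have hRT : ∀ e ∈ R, N.src e ∉ N.support y T := fun e he => hρ₁T e (by simp [he])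
    have hwC : w ∉ N.support o C₁ ∧ w ∉ N.support o C₂ :=
      ⟨fun hc => hwy (hTC w hwT (Or.inl hc)), fun hc => hwy (hTC w hwT (Or.inr hc))⟩
    obtain ⟨T₁, T₂, rfl, hT₁, hT₂⟩ := hT.1.exists_split hwT
    obtain ⟨pT₁, pT₂, hTT⟩ := hT.split hT₁
    have hlen : T₂.length < n := by
      rw [← hn, List.length_append]
      have : T₁ ≠ [] := by
        rintro rfl
        exact hwy hT₁.symm
      have := List.length_pos_iff.2 this
      omega
    -- reroute the walk that was left last along `R`, and prolong the other one along `T₁`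
    have step : ∀ C C' : List E, N.IsWalk C o y → N.IsWalk C' o y →
        (∀ e ∈ C, e ∈ A) → (∀ e ∈ C', e ∈ A) → (∀ e ∈ C, N.src e ≠ y) →
        (∀ x ∈ N.support o C, x ∈ N.support o C' → x = o ∨ x = y) →
        (∀ x ∈ N.support y (T₁ ++ T₂), x ∈ N.support o C ∨ x ∈ N.support o C' → x = y) →
        (∀ e ∈ R, N.tgt e ∉ N.support o C ∧ N.tgt e ∉ N.support o C') →
        w ∉ N.support o C → w ∉ N.support o C' → z ∈ N.support o C →
        ∃ l₁ l₂, N.IsRoute A o d l₁ ∧ N.IsRoute A o d l₂ ∧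
          Disjoint (N.inner o d l₁) (N.inner o d l₂) := by
      intro C C' hC hC' hA hA' hy hCC hTC hRC hwC hwC' hzC
      obtain ⟨Ca, Cb, rfl, hCa, hCb⟩ := hC.exists_split hzC
      have hCa_sub : ∀ x ∈ N.support o Ca, x ∈ N.support o (Ca ++ Cb) := fun x hx =>
        (support_append hCa).2 (Or.inl hx)
      have hyCa : y ∉ N.support o Ca := by
        intro hc
        rcases (hCa.mem_support_iff).1 hc with h | ⟨e, he, h⟩
        · exact hzy h.symm
        · exact hy e (by simp [he]) h
      have hT₁_sub : ∀ x ∈ N.support y T₁, x ∈ N.support y (T₁ ++ T₂) := fun x hx =>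
        (support_append hT₁).2 (Or.inl hx)
      have hT₂_sub : ∀ x ∈ N.support w T₂, x ∈ N.support y (T₁ ++ T₂) := fun x hx =>
        (support_append hT₁).2 (Or.inr hx)
      have hyT₂ : y ∉ N.support w T₂ := fun hc => hwy (hTT y (start_mem_support _ _) hc).symm
      have hRT' : ∀ x ∈ N.support z R, x ∈ N.support y (T₁ ++ T₂) → x = w := by
        intro x hx hxT
        rcases (hR.mem_support_iff).1 hx with h | ⟨e, he, h⟩
        · exact h
        · exact absurd (h ▸ hxT) (hRT e he)
      have hRC' : ∀ x ∈ N.support z R, x ∈ N.support o (Ca ++ Cb) ∨ x ∈ N.support o C' → x = z := by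
        intro x hx hxC
        rcases mem_support.1 hx with h | ⟨e, he, rfl⟩
        · exact h
        · exact absurd hxC (not_or.2 (hRC e he))
      refine ih T₂.length hlen w (Ca ++ R) (C' ++ T₁) T₂ rfl ?_ (hCa.append hR) (hC'.append hT₁) pT₂
        ?_ ?_ ?_ ?_ ?_ ?_ ?_
      · exact fun hc => hwC (hc ▸ start_mem_support _ _)
      · intro e he
        rcases List.mem_append.1 he with he | he
        · exact hA e (by simp [he])
        · exact hRA e he
      · intro e he
        rcases List.mem_append.1 he with he | he
        · exact hA' e he
        · exact hAT e (by simp [he])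
      · exact fun e he => hAT e (by simp [he])
      · intro e he hc
        rcases List.mem_append.1 he with he | he
        · exact hwC (hCa_sub _ (hc ▸ hCa.src_mem_support he))
        · exact hRT e he (hc ▸ hwT)
      · intro e he hc
        rcases List.mem_append.1 he with he | he
        · exact hwC' (hc ▸ hC'.src_mem_support he)
        · exact pT₁.src_ne_end he hc
      · intro x hx hx'
        rw [support_append hCa] at hx
        rw [support_append hC'] at hx'
        have hx1 : x ∈ N.support o Ca → x ∈ N.support o C' → x = o ∨ x = w := fun h h' => by
          rcases hCC x (hCa_sub x h) h' with h1 | rfl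
          · exact Or.inl h1
          · exact absurd h hyCa
        rcases hx with hx | hx
        · rcases hx' with hx' | hx'
          · exact hx1 hx hx'
          · have := hTC x (hT₁_sub x hx') (Or.inl (hCa_sub x hx))
            exact absurd (this ▸ hx) hyCa
        · rcases hx' with hx' | hx'
          · have := hRC' x hx (Or.inr hx')
            subst this
            exact hx1 hCa.end_mem_support hx'
          · exact Or.inr (hRT' x hx (hT₁_sub x hx'))
      · intro x hx hx'
        rw [support_append hCa, support_append hC'] at hx'
        rcases hx' with (hx' | hx') | (hx' | hx')
        · have := hTC x (hT₂_sub x hx) (Or.inl (hCa_sub x hx'))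
          exact absurd (this ▸ hx) hyT₂
        · exact hRT' x hx' (hT₂_sub x hx)
        · have := hTC x (hT₂_sub x hx) (Or.inr hx')
          exact absurd (this ▸ hx) hyT₂
        · exact hTT x hx' hx
    have hRC' : ∀ e ∈ R, N.tgt e ∉ N.support o C₁ ∧ N.tgt e ∉ N.support o C₂ := fun e he =>
      not_or.1 (hRC e he)
    rcases hzC with hzC | hzC
    · exact step C₁ C₂ hC₁ hC₂ hA₁ hA₂ hy₁ hCC hTC hRC' hwC.1 hwC.2 hzC
    · exact step C₂ C₁ hC₂ hC₁ hA₂ hA₁ hy₂ (fun x h h' => hCC x h' h)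
        (fun x h h' => hTC x h h'.symm)
        (fun e he => (hRC' e he).symm) hwC.2 hwC.1 hzC
  obtain ⟨l, hl⟩ := hroute
  cases l with
  | nil => exact absurd hl.1.1 hod
  | cons e l =>
    have hp := IsPath.cons_iff.1 hl.1
    have hw : N.IsWalk [e] o (N.tgt e) := ⟨hp.1, rfl⟩
    have hne : N.tgt e ≠ o := fun hc => hp.2.1 (hc ▸ start_mem_support _ _)
    -- Both walks may start as the same edge: they then share only its two ends.
    refine key l.length (N.tgt e) [e] [e] l rfl hne hw hw hp.2.2 ?_ ?_ ?_ ?_ ?_ ?_ ?_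
    · simpa using hl.2 e (by simp)
    · simpa using hl.2 e (by simp)
    · exact fun f hf => hl.2 f (by simp [hf])
    · simpa [hp.1] using hne.symm
    · simpa [hp.1] using hne.symm
    · intro x hx _
      simpa [support] using hx
    · intro x hx hx'
      rw [or_self] at hx'
      have : x = o ∨ x = N.tgt e := by simpa [support] using hx'
      rcases this with rfl | h
      · exact absurd hx hp.2.1
      · exact h

end Bridges

/-! ### A network is series-parallel or has a bridge -/

section Dichotomy

variable {V E : Type*} {N : ODGraph V E} {A : Set E} {o d : V}

theorem IsRoute.reflTransGen_up {β : V → ℝ} {l : List E} (hl : N.IsRoute A o d l)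
    (hβ : ∀ e ∈ l, β (N.src e) < β (N.tgt e)) {x : V} (hx : x ∈ N.support o l) :
    Relation.ReflTransGen (N.Up A β) o x ∧ Relation.ReflTransGen (N.Up A β) x d := by
  obtain ⟨l₁, l₂, rfl, h1, h2⟩ := hl.1.1.exists_split hx
  exact ⟨h1.reflTransGen_up (fun e he => hl.2 e (by simp [he])) fun e he => hβ e (by simp [he]),
    h2.reflTransGen_up (fun e he => hl.2 e (by simp [he])) fun e he => hβ e (by simp [he])⟩

/-- Two routes without common inner vertices that are joined by a walk form a bridge. -/
theorem hasBridge_of_walk (hod : o ≠ d) {l₁ l₂ q : List E} (h₁ : N.IsRoute A o d l₁)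
    (h₂ : N.IsRoute A o d l₂) (hdisj : Disjoint (N.inner o d l₁) (N.inner o d l₂)) {a b : V}
    (ha : a ∈ N.inner o d l₁) (hb : b ∈ N.inner o d l₂) (hq : N.IsWalk q a b)
    (hqA : ∀ e ∈ q, e ∈ A) (hqod : ∀ x ∈ N.support a q, x ≠ o ∧ x ≠ d) :
    N.HasBridge A o d := by
  classical
  -- A shortest connection between the two routes that avoids `o` and `d` has no intermediate vertex
  -- on either route, so β can be prescribed there freely.
  let Q : ℕ → Prop := fun n => ∃ w : ℕ → V, w 0 ∈ N.inner o d l₁ ∧ w n ∈ N.inner o d l₂ ∧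
    (∀ i < n, ∃ e ∈ A, N.src e = w i ∧ N.tgt e = w (i + 1)) ∧ ∀ i ≤ n, w i ≠ o ∧ w i ≠ d
  have hQ : ∃ n, Q n := by
    obtain ⟨w, h0, h1, hs, hm⟩ := hq.exists_seq
    refine ⟨q.length, w, h0 ▸ ha, h1 ▸ hb, fun i hi => ?_, fun i hi => hqod _ (hm i hi)⟩
    obtain ⟨e, he, h⟩ := hs i hi
    exact ⟨e, hqA e he, h⟩
  have hmin : ∀ m < Nat.find hQ, ¬ Q m := fun m hm => Nat.find_min hQ hm
  obtain ⟨w, hw0, hwn, hws, hwod⟩ := Nat.find_spec hQ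
  set n := Nat.find hQ
  have hint : ∀ i, 0 < i → i < n → w i ∉ N.inner o d l₁ ∧ w i ∉ N.inner o d l₂ := by
    intro i h0 hi
    constructor
    · intro hc
      refine hmin (n - i) (by omega) ⟨fun j => w (i + j), by simpa using hc, ?_, fun j hj => ?_,
        fun j hj => hwod _ (by omega)⟩
      · have : i + (n - i) = n := by omega
        simpa only [this] using hwn
      · exact hws (i + j) (by omega)
    · intro hc
      exact hmin i hi ⟨w, hw0, hc, fun j hj => hws j (by omega), fun j hj => hwod _ (by omega)⟩
  obtain ⟨f, hf0, hfp, hf⟩ := h₁.1.exists_height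
  obtain ⟨g, hg0, hgp, hg⟩ := h₂.1.exists_height
  have hfn : ∀ x, 0 ≤ f x := fun x => by
    by_cases hx : x = o
    · rw [hx, hf0]
    · exact (hfp x hx).le
  have hgn : ∀ x, 0 ≤ g x := fun x => by
    by_cases hx : x = o
    · rw [hx, hg0]
    · exact (hgp x hx).le
  -- Heights along the two routes, shifted to vanish at the ends of the connection; zero off the
  -- routes; low enough at `o` and high enough at `d` for both routes to stay increasing.
  set β : V → ℝ := fun x => if x = o then -(f (w 0) + g (w n) + 1) else if x = d then f d + g d
    else if x ∈ N.inner o d l₁ then f x - f (w 0) else if x ∈ N.inner o d l₂ then g x - g (w n)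
    else 0 with hβdef
  have hβo : β o = -(f (w 0) + g (w n) + 1) := by simp [hβdef]
  have hβd : β d = f d + g d := by simp [hβdef, hod.symm]
  have hβ1 : ∀ x ∈ N.inner o d l₁, β x = f x - f (w 0) := fun x hx => by
    simp [hβdef, hx.2.1, hx.2.2, hx]
  have hβ2 : ∀ x ∈ N.inner o d l₂, β x = g x - g (w n) := fun x hx => by
    simp [hβdef, hx.2.1, hx.2.2, hx, Set.disjoint_right.1 hdisj hx]
  have hup1 : ∀ e ∈ l₁, β (N.src e) < β (N.tgt e) := by
    intro e he
    have h := hf e he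
    have hs : β (N.src e) ≤ f (N.src e) - f (w 0) := by
      by_cases hs : N.src e = o
      · rw [hs, hβo, hf0]
        linarith [hgn (w n)]
      · exact (hβ1 _ ⟨h₁.1.1.src_mem_support he, hs, h₁.1.src_ne_end he⟩).le
    have ht : f (N.tgt e) - f (w 0) ≤ β (N.tgt e) := by
      by_cases ht : N.tgt e = d
      · rw [ht, hβd]
        linarith [hgn d, hfn (w 0)]
      · exact (hβ1 _ ⟨tgt_mem_support he, h₁.1.tgt_ne_start he, ht⟩).ge
    linarith
  have hup2 : ∀ e ∈ l₂, β (N.src e) < β (N.tgt e) := by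
    intro e he
    have h := hg e he
    have hs : β (N.src e) ≤ g (N.src e) - g (w n) := by
      by_cases hs : N.src e = o
      · rw [hs, hβo, hg0]
        linarith [hfn (w 0)]
      · exact (hβ2 _ ⟨h₂.1.1.src_mem_support he, hs, h₂.1.src_ne_end he⟩).le
    have ht : g (N.tgt e) - g (w n) ≤ β (N.tgt e) := by
      by_cases ht : N.tgt e = d
      · rw [ht, hβd]
        linarith [hfn d, hgn (w n)]
      · exact (hβ2 _ ⟨tgt_mem_support he, h₂.1.tgt_ne_start he, ht⟩).ge
    linarith
  have hl0 : β (w 0) = 0 := by rw [hβ1 _ hw0, sub_self]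
  refine ⟨β, n, w, fun hc => Set.disjoint_left.1 hdisj hw0 (hc ▸ hwn), hws, fun i hi => ?_,
    (h₁.reflTransGen_up hup1 hw0.1).1, (h₁.reflTransGen_up hup1 hw0.1).2,
    (h₂.reflTransGen_up hup2 hwn.1).1, (h₂.reflTransGen_up hup2 hwn.1).2⟩
  rw [hl0]
  rcases Nat.eq_zero_or_pos i with rfl | h0
  · exact hl0
  rcases hi.eq_or_lt with rfl | hi'
  · rw [hβ2 _ hwn, sub_self]
  · simp [hβdef, hwod i hi, hint i h0 hi']

/-- If two routes without common inner vertices meet the same route, there is a bridge. -/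
theorem hasBridge_of_not_trans (hod : o ≠ d) {l₁ l l₂ : List E} (h₁ : N.IsRoute A o d l₁)
    (h : N.IsRoute A o d l) (h₂ : N.IsRoute A o d l₂)
    (hdisj : Disjoint (N.inner o d l₁) (N.inner o d l₂))
    (hm₁ : ¬ Disjoint (N.inner o d l₁) (N.inner o d l))
    (hm₂ : ¬ Disjoint (N.inner o d l) (N.inner o d l₂)) : N.HasBridge A o d := by
  obtain ⟨a, ha₁, ha⟩ := Set.not_disjoint_iff.1 hm₁
  obtain ⟨b, hb, hb₂⟩ := Set.not_disjoint_iff.1 hm₂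
  -- the piece of the route between two of its inner vertices
  have piece : ∀ p q s : List E, ∀ x y : V, l = p ++ (q ++ s) → N.IsWalk p o x → N.IsWalk q x y →
      N.IsWalk s y d → x ≠ o → y ≠ d → ∀ z ∈ N.support x q, z ≠ o ∧ z ≠ d := by
    intro p q s x y hl hp hq hs hxo hyd z hz
    have hpath := h.1
    rw [hl] at hpath
    obtain ⟨-, hqs, hd₁⟩ := hpath.split hp
    obtain ⟨-, -, hd₂⟩ := hqs.split hq
    constructor
    · rintro rfl
      exact hxo (hd₁ z (start_mem_support _ _) ((support_append hq).2 (Or.inl hz))).symm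
    · rintro rfl
      exact hyd (hd₂ z hz hs.end_mem_support).symm
  obtain ⟨p, s, hl, hp, hs⟩ := h.1.1.exists_split ha.1
  have hb' := hb.1
  rw [hl, support_append hp] at hb'
  rcases hb' with hb' | hb'
  · obtain ⟨p', q, rfl, hp', hq⟩ := hp.exists_split hb'
    exact hasBridge_of_walk hod h₂ h₁ hdisj.symm hb₂ ha₁ hq (fun e he => h.2 e (by simp [hl, he]))
      (piece p' q s b a (by rw [hl, List.append_assoc]) hp' hq hs hb.2.1 ha.2.2)
  · obtain ⟨q, s', rfl, hq, hs'⟩ := hs.exists_split hb'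
    exact hasBridge_of_walk hod h₁ h₂ hdisj ha₁ hb₂ hq (fun e he => h.2 e (by simp [hl, he]))
      (piece p q s' a b hl hp hq hs' ha.2.1 hb.2.2)

theorem IsNet.exists_isRoute (h : N.IsNet A o d) : ∃ l, N.IsRoute A o d l := by
  obtain ⟨e, he⟩ := h.nonempty
  obtain ⟨l, hl, -⟩ := h.mem_route e he
  exact ⟨l, hl⟩

theorem IsWalk.src_mem_or_eq {l : List E} {v u : V} (h : N.IsWalk l v u) :
    v = u ∨ ∃ e ∈ l, N.src e = v := by
  cases l with
  | nil => exact Or.inl h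
  | cons e l => exact Or.inr ⟨e, by simp, h.1⟩

theorem IsWalk.tgt_mem_or_eq {l : List E} {v u : V} (h : N.IsWalk l v u) :
    u = v ∨ ∃ e ∈ l, N.tgt e = u :=
  mem_support.1 h.end_mem_support

theorem IsNet.origin_mem_verts (h : N.IsNet A o d) : o ∈ N.verts A := by
  obtain ⟨l, hl⟩ := h.exists_isRoute
  rcases hl.1.1.src_mem_or_eq with h' | ⟨e, he, h'⟩
  · exact absurd h' h.ne
  · exact ⟨e, hl.2 e he, Or.inl h'⟩

theorem IsNet.dest_mem_verts (h : N.IsNet A o d) : d ∈ N.verts A := by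
  obtain ⟨l, hl⟩ := h.exists_isRoute
  rcases hl.1.1.tgt_mem_or_eq with h' | ⟨e, he, h'⟩
  · exact absurd h'.symm h.ne
  · exact ⟨e, hl.2 e he, Or.inr h'⟩

/-- Carries a bridge from a part of the network to the whole. Only the values of β on the vertices
of the part matter to the bridge, so β is free elsewhere to make the connections to the new
terminals increase. -/
theorem IsBridge.of_agree {B : Set E} {o' d' : V} {β β' : V → ℝ} {k : ℕ} {w : ℕ → V}
    (h : N.IsBridge A o d β k w) (hAB : A ⊆ B) (hβ : ∀ x ∈ N.verts A, β' x = β x)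
    (ho : Relation.ReflTransGen (N.Up B β') o' o) (hd : Relation.ReflTransGen (N.Up B β') d d') :
    N.IsBridge B o' d' β' k w := by
  have hm {x y : V} (hxy : Relation.ReflTransGen (N.Up A β) x y) :
      Relation.ReflTransGen (N.Up B β') x y := by
    refine Relation.ReflTransGen.mono (fun x y hxy => ?_) _ _ hxy
    obtain ⟨e, he, rfl, rfl, hlt⟩ := hxy
    refine ⟨e, hAB he, rfl, rfl, ?_⟩
    rwa [hβ _ ⟨e, he, Or.inl rfl⟩, hβ _ ⟨e, he, Or.inr rfl⟩]
  have hk : 0 < k := Nat.pos_of_ne_zero fun hk => h.ne (by rw [hk])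
  have hv : ∀ i ≤ k, w i ∈ N.verts A := by
    intro i hi
    rcases hi.eq_or_lt with rfl | hi
    · obtain ⟨e, he, -, h2⟩ := h.step (i - 1) (by omega)
      rw [Nat.sub_add_cancel hk] at h2
      exact ⟨e, he, Or.inr h2⟩
    · obtain ⟨e, he, h1, -⟩ := h.step i hi
      exact ⟨e, he, Or.inl h1⟩
  refine ⟨h.ne, fun i hi => (h.step i hi).imp fun e he => ⟨hAB he.1, he.2⟩, fun i hi => ?_,
    ho.trans (hm h.left_in), (hm h.left_out).trans hd, ho.trans (hm h.right_in),
    (hm h.right_out).trans hd⟩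
  rw [hβ _ (hv i hi), hβ _ (hv 0 (Nat.zero_le _)), h.level i hi]

/-- The edges that routes use before they visit `m`. -/
def before (N : ODGraph V E) (A : Set E) (o d m : V) : Set E :=
  {e | ∃ l₁ l₂, N.IsRoute A o d (l₁ ++ l₂) ∧ N.IsWalk l₁ o m ∧ N.IsWalk l₂ m d ∧ e ∈ l₁}

/-- The edges that routes use after they visited `m`. -/
def after (N : ODGraph V E) (A : Set E) (o d m : V) : Set E :=
  {e | ∃ l₁ l₂, N.IsRoute A o d (l₁ ++ l₂) ∧ N.IsWalk l₁ o m ∧ N.IsWalk l₂ m d ∧ e ∈ l₂}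

/-- A vertex that lies on all routes splits a network in two, connected in series. -/
theorem IsNet.series_split (h : N.IsNet A o d) {m : V} (hmo : m ≠ o) (hmd : m ≠ d)
    (hm : ∀ l, N.IsRoute A o d l → m ∈ N.support o l) :
    N.before A o d m ∪ N.after A o d m = A ∧ N.IsNet (N.before A o d m) o m ∧
      N.IsNet (N.after A o d m) m d ∧
      N.verts (N.before A o d m) ∩ N.verts (N.after A o d m) = {m} := by
  have hb : N.IsNet (N.before A o d m) o m := by
    refine ⟨hmo.symm, ?_, ?_⟩
    · obtain ⟨l, hl⟩ := h.exists_isRoute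
      obtain ⟨l₁, l₂, rfl, h1, h2⟩ := hl.1.1.exists_split (hm l hl)
      rcases h1.src_mem_or_eq with h' | ⟨e, he, -⟩
      · exact absurd h'.symm hmo
      · exact ⟨e, l₁, l₂, hl, h1, h2, he⟩
    · rintro e ⟨l₁, l₂, hl, h1, h2, he⟩
      exact ⟨l₁, ⟨(hl.1.split h1).1, fun f hf => ⟨l₁, l₂, hl, h1, h2, hf⟩⟩, he⟩
  have ha : N.IsNet (N.after A o d m) m d := by
    refine ⟨hmd, ?_, ?_⟩
    · obtain ⟨l, hl⟩ := h.exists_isRoute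
      obtain ⟨l₁, l₂, rfl, h1, h2⟩ := hl.1.1.exists_split (hm l hl)
      rcases h2.src_mem_or_eq with h' | ⟨e, he, -⟩
      · exact absurd h' hmd
      · exact ⟨e, l₁, l₂, hl, h1, h2, he⟩
    · rintro e ⟨l₁, l₂, hl, h1, h2, he⟩
      exact ⟨l₂, ⟨(hl.1.split h1).2.1, fun f hf => ⟨l₁, l₂, hl, h1, h2, hf⟩⟩, he⟩
  refine ⟨?_, hb, ha, ?_⟩
  · ext e
    constructor
    · rintro (⟨l₁, l₂, hl, -, -, he⟩ | ⟨l₁, l₂, hl, -, -, he⟩)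
      · exact hl.2 e (by simp [he])
      · exact hl.2 e (by simp [he])
    · intro he
      obtain ⟨l, hl, hel⟩ := h.mem_route e he
      obtain ⟨l₁, l₂, rfl, h1, h2⟩ := hl.1.1.exists_split (hm l hl)
      rcases List.mem_append.1 hel with he | he
      · exact Or.inl ⟨l₁, l₂, hl, h1, h2, he⟩
      · exact Or.inr ⟨l₁, l₂, hl, h1, h2, he⟩
  · ext x
    constructor
    · rintro ⟨⟨e, ⟨l₁, l₂, hl, h1, h2, he⟩, hx⟩, ⟨f, ⟨k₁, k₂, hk, g1, g2, hf⟩, hx'⟩⟩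
      by_contra hxm
      have hxm : x ≠ m := hxm
      have hxl : x ∈ N.support o l₁ := by
        rcases hx with rfl | rfl
        · exact h1.src_mem_support he
        · exact tgt_mem_support he
      have hxk : x ∈ N.support m k₂ := by
        rcases hx' with rfl | rfl
        · exact g2.src_mem_support hf
        · exact tgt_mem_support hf
      -- Following the first route up to `x` and the second one from `x` on gives a walk to `d` that
      -- misses `m`, against `hm`.
      obtain ⟨a, a', rfl, ha, ha'⟩ := h1.exists_split hxl
      obtain ⟨b, b', rfl, hb, hb'⟩ := g2.exists_split hxk
      have hma : m ∉ N.support o a := fun hc =>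
        hxm (((hl.1.split h1).1.split ha).2.2 m hc ha'.end_mem_support).symm
      have hmb : m ∉ N.support x b' := fun hc =>
        hxm (((hk.1.split g1).2.1.split hb).2.2 m (start_mem_support _ _) hc).symm
      obtain ⟨l, hlr, hls⟩ := (ha.append hb').exists_isRoute (A := A) (by
        intro g hg
        rcases List.mem_append.1 hg with hg | hg
        · exact hl.2 g (by simp [hg])
        · exact hk.2 g (by simp [hg]))
      have := support_subset hls (hm l hlr)
      rw [support_append ha] at this
      exact this.elim hma hmb
    · rintro rfl
      exact ⟨hb.dest_mem_verts, ha.origin_mem_verts⟩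

/-- If one part has a bridge, β extends to the other part by the height along one of its routes,
shifted to agree at `m`. There is no conflict because the parts share only `m`. -/
theorem isSPFrom_or_hasBridge_of_series (h : N.IsNet A o d) {m : V} (hmo : m ≠ o) (hmd : m ≠ d)
    (hm : ∀ l, N.IsRoute A o d l → m ∈ N.support o l)
    (h₁ : N.IsSPFrom (N.before A o d m) o m ∨ N.HasBridge (N.before A o d m) o m)
    (h₂ : N.IsSPFrom (N.after A o d m) m d ∨ N.HasBridge (N.after A o d m) m d) :
    N.IsSPFrom A o d ∨ N.HasBridge A o d := by
  classical
  obtain ⟨hU, hb, ha, hv⟩ := h.series_split hmo hmd hm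
  have hbA : N.before A o d m ⊆ A := Set.subset_union_left.trans hU.subset
  have haA : N.after A o d m ⊆ A := Set.subset_union_right.trans hU.subset
  have hcap : ∀ {x}, x ∈ N.verts (N.before A o d m) → x ∈ N.verts (N.after A o d m) → x = m :=
    fun {x} hx hx' => by
      have : x ∈ ({m} : Set V) := hv ▸ ⟨hx, hx'⟩
      exact this
  rcases h₁ with h₁ | ⟨β, k, w, hw⟩
  · rcases h₂ with h₂ | ⟨β, k, w, hw⟩
    · left
      have := IsSPFrom.series h₁ h₂ hv
      rwa [hU] at this
    · right
      obtain ⟨l, hl⟩ := hb.exists_isRoute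
      obtain ⟨f, hf0, hfp, hf⟩ := hl.1.exists_height
      set β' : V → ℝ := fun x => if x ∈ N.verts (N.after A o d m) then β x else β m + f x - f m
        with hβ'
      refine ⟨β', k, w, IsBridge.of_agree hw haA (fun x hx => by simp [hβ', hx]) ?_ .refl⟩
      have hval : ∀ x ∈ N.verts (N.before A o d m), β' x = β m + f x - f m := by
        intro x hx
        by_cases hx' : x ∈ N.verts (N.after A o d m)
        · simp [hβ', hcap hx hx', ha.origin_mem_verts]
        · simp [hβ', hx']
      refine hl.1.1.reflTransGen_up (fun e he => hbA (hl.2 e he)) fun e he => ?_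
      rw [hval _ ⟨e, hl.2 e he, Or.inl rfl⟩, hval _ ⟨e, hl.2 e he, Or.inr rfl⟩]
      linarith [hf e he]
  · right
    obtain ⟨l, hl⟩ := ha.exists_isRoute
    obtain ⟨f, hf0, hfp, hf⟩ := hl.1.exists_height
    set β' : V → ℝ := fun x => if x ∈ N.verts (N.before A o d m) then β x else β m + f x
      with hβ'
    refine ⟨β', k, w, IsBridge.of_agree hw hbA (fun x hx => by simp [hβ', hx]) .refl ?_⟩
    have hval : ∀ x ∈ N.verts (N.after A o d m), β' x = β m + f x := by
      intro x hx
      by_cases hx' : x ∈ N.verts (N.before A o d m)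
      · simp [hβ', hcap hx' hx, hb.dest_mem_verts, hf0]
      · simp [hβ', hx']
    refine hl.1.1.reflTransGen_up (fun e he => haA (hl.2 e he)) fun e he => ?_
    rw [hval _ ⟨e, hl.2 e he, Or.inl rfl⟩, hval _ ⟨e, hl.2 e he, Or.inr rfl⟩]
    linarith [hf e he]

/-- A union of routes is a network. -/
theorem isNet_of_routes (hod : o ≠ d) {P : List E → Prop}
    (hP : ∃ l, N.IsRoute A o d l ∧ P l) :
    N.IsNet {e | ∃ l, N.IsRoute A o d l ∧ P l ∧ e ∈ l} o d := by
  refine ⟨hod, ?_, ?_⟩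
  · obtain ⟨l, hl, hPl⟩ := hP
    rcases hl.1.1.src_mem_or_eq with h' | ⟨e, he, -⟩
    · exact absurd h' hod
    · exact ⟨e, l, hl, hPl, he⟩
  · rintro e ⟨l, hl, hPl, he⟩
    exact ⟨l, ⟨hl.1, fun f hf => ⟨l, hl, hPl, hf⟩⟩, he⟩

theorem isSPFrom_or_hasBridge_of_parallel {A₁ A₂ : Set E} (h₁ : N.IsNet A₁ o d)
    (h₂ : N.IsNet A₂ o d) (hdisj : Disjoint A₁ A₂)
    (hv : ∀ x ∈ N.verts A₁, x ∈ N.verts A₂ → x = o ∨ x = d)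
    (hs₁ : N.IsSPFrom A₁ o d ∨ N.HasBridge A₁ o d)
    (hs₂ : N.IsSPFrom A₂ o d ∨ N.HasBridge A₂ o d) :
    N.IsSPFrom (A₁ ∪ A₂) o d ∨ N.HasBridge (A₁ ∪ A₂) o d := by
  rcases hs₁ with hs₁ | hs₁
  · rcases hs₂ with hs₂ | hs₂
    · refine Or.inl (hs₁.parallel hs₂ hdisj (Set.Subset.antisymm (fun x hx => hv x hx.1 hx.2) ?_))
      rintro x (rfl | rfl)
      · exact ⟨h₁.origin_mem_verts, h₂.origin_mem_verts⟩
      · exact ⟨h₁.dest_mem_verts, h₂.dest_mem_verts⟩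
    · exact Or.inr (hs₂.mono Set.subset_union_right)
  · exact Or.inr (hs₁.mono Set.subset_union_left)

/-- A network without bridges is series-parallel. -/
theorem IsNet.isSPFrom_or_hasBridge [Finite E] (h : N.IsNet A o d) :
    N.IsSPFrom A o d ∨ N.HasBridge A o d := by
  induction hn : A.ncard using Nat.strong_induction_on generalizing A o d with
  | _ n ih =>
  have ih' : ∀ {B : Set E} {o' d' : V}, B ⊂ A → N.IsNet B o' d' →
      N.IsSPFrom B o' d' ∨ N.HasBridge B o' d' := fun {B o' d'} hB hBn =>
    ih B.ncard (hn ▸ Set.ncard_lt_ncard hB) hBn rfl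
  by_cases hedge : ∃ e ∈ A, N.src e = o ∧ N.tgt e = d
  · obtain ⟨e, heA, rfl, rfl⟩ := hedge
    have hsingle : N.IsSPFrom {e} (N.src e) (N.tgt e) := .single e h.ne
    by_cases hA : A = {e}
    · exact Or.inl (hA ▸ hsingle)
    have he1 : N.IsNet {e} (N.src e) (N.tgt e) :=
      ⟨h.ne, ⟨e, rfl⟩, fun f hf => ⟨[e], ⟨⟨⟨rfl, rfl⟩, by simpa using h.ne⟩, by simp⟩, by
        simpa using hf⟩⟩
    have hroute : ∀ l, N.IsRoute A (N.src e) (N.tgt e) l → e ∈ l → l = [e] := by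
      intro l hl hel
      cases l with
      | nil => simp at hel
      | cons f l =>
        have hp := IsPath.cons_iff.1 hl.1
        rcases List.mem_cons.1 hel with rfl | he
        · cases l with
          | nil => rfl
          | cons g l =>
            exact absurd hp.2.2.1.1 (hp.2.2.src_ne_end (by simp))
        · exact absurd (hp.2.2.1.src_mem_support he) hp.2.1
    have he2 : N.IsNet (A \ {e}) (N.src e) (N.tgt e) := by
      refine ⟨h.ne, ?_, fun f hf => ?_⟩
      · by_contra hc
        rw [Set.not_nonempty_iff_eq_empty, Set.sdiff_eq_empty] at hc
        exact hA (Set.Subset.antisymm hc (by simpa using heA))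
      · obtain ⟨l, hl, hfl⟩ := h.mem_route f hf.1
        refine ⟨l, ⟨hl.1, fun g hg => ⟨hl.2 g hg, ?_⟩⟩, hfl⟩
        rintro rfl
        rw [hroute l hl hg] at hfl
        exact hf.2 (by simpa using hfl)
    have := isSPFrom_or_hasBridge_of_parallel he1 he2 Set.disjoint_sdiff_right (fun x hx _ => ?_)
      (Or.inl hsingle) (ih' ⟨Set.sdiff_subset, fun hc => (hc heA).2 rfl⟩ he2)
    · rwa [Set.union_sdiff_cancel (by simpa using heA)] at this
    · obtain ⟨f, rfl, hf⟩ := hx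
      exact hf.imp Eq.symm Eq.symm
  have hedge' : ∀ e ∈ A, ¬ (N.src e = o ∧ N.tgt e = d) := fun e he hc => hedge ⟨e, he, hc⟩
  by_cases hcut : ∃ m, m ≠ o ∧ m ≠ d ∧ ∀ l, N.IsRoute A o d l → m ∈ N.support o l
  · obtain ⟨m, hmo, hmd, hm⟩ := hcut
    obtain ⟨hU, hb, ha, hv⟩ := h.series_split hmo hmd hm
    have hdisj : ∀ e ∈ N.before A o d m, e ∉ N.after A o d m := by
      intro e he he'
      obtain ⟨l, hl, hel⟩ := hb.mem_route e he
      have h1 : N.src e ∈ ({m} : Set V) := hv ▸ ⟨⟨e, he, Or.inl rfl⟩, ⟨e, he', Or.inl rfl⟩⟩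
      exact hl.1.src_ne_end hel h1
    refine isSPFrom_or_hasBridge_of_series h hmo hmd hm
      (ih' ⟨Set.subset_union_left.trans hU.subset, ?_⟩ hb)
      (ih' ⟨Set.subset_union_right.trans hU.subset, ?_⟩ ha)
    · obtain ⟨e, he⟩ := ha.nonempty
      exact fun hc => hdisj e (hc (hU.subset (Or.inr he))) he
    · obtain ⟨e, he⟩ := hb.nonempty
      exact fun hc => hdisj e he (hc (hU.subset (Or.inl he)))
  push Not at hcut
  obtain ⟨l₁, l₂, hl₁, hl₂, hl⟩ := exists_disjoint_routes h.ne hedge' h.exists_isRoute hcut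
  by_cases htrans : ∃ l l' , N.IsRoute A o d l ∧ N.IsRoute A o d l' ∧
      ¬ Disjoint (N.inner o d l₁) (N.inner o d l) ∧ ¬ Disjoint (N.inner o d l) (N.inner o d l') ∧
      Disjoint (N.inner o d l₁) (N.inner o d l')
  · obtain ⟨l, l', h1, h2, h3, h4, h5⟩ := htrans
    exact Or.inr (hasBridge_of_not_trans h.ne hl₁ h1 h2 h5 h3 h4)
  push Not at htrans
  have hself : ¬ Disjoint (N.inner o d l₁) (N.inner o d l₁) := by
    rcases hl₁.1.1.src_mem_or_eq with h' | ⟨e, he, -⟩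
    · exact absurd h' h.ne
    · obtain ⟨x, hx, -⟩ := hl₁.mem_inner_of_mem he (hedge' e (hl₁.2 e he))
      exact Set.not_disjoint_iff.2 ⟨x, hx, hx⟩
  -- Routes are sorted by whether they meet `l₁` at an inner vertex. By `htrans`, routes of
  -- different kinds share no inner vertex, so the two unions are connected in parallel.
  set A₁ : Set E := {e |
      ∃ l, N.IsRoute A o d l ∧ ¬ Disjoint (N.inner o d l₁) (N.inner o d l) ∧ e ∈ l}
    with hA₁
  set A₂ : Set E := {e |
      ∃ l, N.IsRoute A o d l ∧ Disjoint (N.inner o d l₁) (N.inner o d l) ∧ e ∈ l}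
    with hA₂
  have hn₁ : N.IsNet A₁ o d := isNet_of_routes h.ne ⟨l₁, hl₁, hself⟩
  have hn₂ : N.IsNet A₂ o d := isNet_of_routes h.ne ⟨l₂, hl₂, hl⟩
  have hU : A₁ ∪ A₂ = A := by
    ext e
    constructor
    · rintro (⟨l, hl, -, he⟩ | ⟨l, hl, -, he⟩)
      · exact hl.2 e he
      · exact hl.2 e he
    · intro he
      obtain ⟨l, hl, hel⟩ := h.mem_route e he
      by_cases hd : Disjoint (N.inner o d l₁) (N.inner o d l)
      · exact Or.inr ⟨l, hl, hd, hel⟩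
      · exact Or.inl ⟨l, hl, hd, hel⟩
  have hv : ∀ x ∈ N.verts A₁, x ∈ N.verts A₂ → x = o ∨ x = d := by
    rintro x ⟨e, ⟨l, hlr, hld, hel⟩, hx⟩ ⟨f, ⟨k, hkr, hkd, hfk⟩, hx'⟩
    by_contra hc
    push Not at hc
    have hxl : x ∈ N.support o l := by
      rcases hx with rfl | rfl
      · exact hlr.1.1.src_mem_support hel
      · exact tgt_mem_support hel
    have hxk : x ∈ N.support o k := by
      rcases hx' with rfl | rfl
      · exact hkr.1.1.src_mem_support hfk
      · exact tgt_mem_support hfk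
    exact htrans l k hlr hkr hld (Set.not_disjoint_iff.2 ⟨x, ⟨hxl, hc⟩, ⟨hxk, hc⟩⟩) hkd
  have hdisj : Disjoint A₁ A₂ := by
    refine Set.disjoint_left.2 fun e he he' => ?_
    obtain ⟨l, hlr, -, hel⟩ := id he
    obtain ⟨x, hx, hxe⟩ := hlr.mem_inner_of_mem hel (hedge' e (hlr.2 e hel))
    rcases hv x ⟨e, he, hxe⟩ ⟨e, he', hxe⟩ with h1 | h1
    · exact hx.2.1 h1
    · exact hx.2.2 h1
  have := isSPFrom_or_hasBridge_of_parallel hn₁ hn₂ hdisj hv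
    (ih' ⟨Set.subset_union_left.trans hU.subset, fun hc => ?_⟩ hn₁)
    (ih' ⟨Set.subset_union_right.trans hU.subset, fun hc => ?_⟩ hn₂)
  · rwa [hU] at this
  · obtain ⟨e, he⟩ := hn₂.nonempty
    exact Set.disjoint_left.1 hdisj (hc (hU.subset (Or.inr he))) he
  · obtain ⟨e, he⟩ := hn₁.nonempty
    exact Set.disjoint_left.1 hdisj he (hc (hU.subset (Or.inl he)))

end Dichotomy

/-! ### Making every increasing edge part of an increasing route -/

section Balancing

variable {V E : Type*} {N : ODGraph V E}

/-- A function given on `F` extends to one for which each vertex outside `F` has a lower in-neighbor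
if and only if it has a higher out-neighbor: a fixed point of the mean of the largest value at an
out-neighbor and the smallest value at an in-neighbor. -/
theorem exists_balanced [Finite V] (β₀ : V → ℝ) (F : Set V)
    (hF : ∀ x ∉ F, (∃ e, N.tgt e = x) ∧ ∃ e, N.src e = x) :
    ∃ β : V → ℝ, (∀ x ∈ F, β x = Real.exp (β₀ x)) ∧ ∀ x ∉ F,
      (∃ e, N.tgt e = x ∧ β (N.src e) < β x) ↔ ∃ e, N.src e = x ∧ β x < β (N.tgt e) := by
  classical
  -- Monotone on a complete lattice, so a least fixed point exists; the exponential makes the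
  -- prescribed values nonnegative and keeps their order. At a fixed point, supremum plus infimum is
  -- twice the value, so one is strictly above it exactly when the other is strictly below.
  let T : (V → ℝ≥0∞) →o (V → ℝ≥0∞) :=
    { toFun := fun g x => if x ∈ F then ENNReal.ofReal (Real.exp (β₀ x)) else
        ((⨆ (e : E) (_ : N.src e = x), g (N.tgt e)) + ⨅ (e : E) (_ : N.tgt e = x), g (N.src e)) / 2
      monotone' := by
        intro g g' hg x
        dsimp only
        split_ifs
        · exact le_rfl
        · gcongr
          · exact hg _
          · exact hg _ }
  set g : V → ℝ≥0∞ := T.lfp with hg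
  have hTg : ∀ x, T g x = g x := fun x => congrFun T.map_lfp x
  obtain ⟨M, hM⟩ := (Set.finite_range fun x => Real.exp (β₀ x)).bddAbove
  have hgM : ∀ x, g x ≤ ENNReal.ofReal M := by
    refine T.lfp_le (a := fun _ => ENNReal.ofReal M) fun x => ?_
    change (if x ∈ F then _ else _) ≤ _
    split_ifs with hx
    · exact ENNReal.ofReal_le_ofReal (hM ⟨x, rfl⟩)
    · obtain ⟨⟨e, he⟩, -⟩ := hF x hx
      refine ENNReal.div_le_of_le_mul ?_
      rw [mul_two]
      exact add_le_add (iSup₂_le fun _ _ => le_rfl) (iInf₂_le e he)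
  have hfin : ∀ x, g x ≠ ⊤ := fun x => ((hgM x).trans_lt ENNReal.ofReal_lt_top).ne
  have hlt : ∀ x y, (g x).toReal < (g y).toReal ↔ g x < g y := fun x y =>
    ENNReal.toReal_lt_toReal (hfin x) (hfin y)
  refine ⟨fun x => (g x).toReal, fun x hx => ?_, fun x hx => ?_⟩
  · dsimp only
    rw [← hTg x]
    change (if x ∈ F then _ else _ : ℝ≥0∞).toReal = _
    rw [if_pos hx, ENNReal.toReal_ofReal (Real.exp_pos _).le]
  · simp only [hlt]
    have hsup : (∃ e, N.src e = x ∧ g x < g (N.tgt e)) ↔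
        g x < ⨆ (e : E) (_ : N.src e = x), g (N.tgt e) := by
      simp [lt_iSup_iff]
    have hinf : (∃ e, N.tgt e = x ∧ g (N.src e) < g x) ↔
        ⨅ (e : E) (_ : N.tgt e = x), g (N.src e) < g x := by
      simp [iInf_lt_iff]
    rw [hsup, hinf]
    have h := hTg x
    change (if x ∈ F then _ else _) = _ at h
    rw [if_neg hx] at h
    replace h := congrArg (· * (2 : ℝ≥0∞)) h
    simp only [ENNReal.div_mul_cancel two_ne_zero ENNReal.ofNat_ne_top, mul_two] at h
    constructor
    · intro hi
      by_contra hs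
      exact (ENNReal.add_lt_add_of_le_of_lt
        (ne_top_of_le_ne_top (hfin x) (not_lt.1 hs)) (not_lt.1 hs) hi).ne h
    · intro hs
      by_contra hi
      have := ENNReal.add_lt_add_of_lt_of_le (hfin x) hs (not_lt.1 hi)
      exact this.ne' h

/-- A small perturbation preserves all strict inequalities along edges. -/
theorem exists_perturbation [Finite E] (β f : V → ℝ) :
    ∃ ε : ℝ, 0 < ε ∧ ∀ e, β (N.src e) < β (N.tgt e) →
      β (N.src e) + ε * f (N.src e) < β (N.tgt e) + ε * f (N.tgt e) := by
  have h : ∀ e, ∀ᶠ ε : ℝ in 𝓝[>] 0, β (N.src e) < β (N.tgt e) →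
      β (N.src e) + ε * f (N.src e) < β (N.tgt e) + ε * f (N.tgt e) := by
    intro e
    by_cases he : β (N.src e) < β (N.tgt e)
    · have h1 : Tendsto (fun ε : ℝ => β (N.src e) + ε * f (N.src e)) (𝓝[>] 0)
          (𝓝 (β (N.src e) + 0 * f (N.src e))) :=
        (Continuous.tendsto (by fun_prop) 0).mono_left nhdsWithin_le_nhds
      have h2 : Tendsto (fun ε : ℝ => β (N.tgt e) + ε * f (N.tgt e)) (𝓝[>] 0)
          (𝓝 (β (N.tgt e) + 0 * f (N.tgt e))) :=
        (Continuous.tendsto (by fun_prop) 0).mono_left nhdsWithin_le_nhds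
      filter_upwards [h1.eventually_lt h2 (by simpa using he)] with ε hε _ using hε
    · exact Eventually.of_forall fun _ hc => absurd hc he
  obtain ⟨ε, hε, h0⟩ := ((eventually_all.2 h).and self_mem_nhdsWithin).exists
  exact ⟨ε, h0, hε⟩

theorem exists_extension {k : ℕ} {w : ℕ → V} (hw : Set.InjOn w (Set.Iic k)) (g : ℕ → ℝ) :
    ∃ f : V → ℝ, ∀ i ≤ k, f (w i) = g i :=
  ⟨fun x => g (Function.invFunOn w (Set.Iic k) x), fun i hi => by
    dsimp only
    rw [hw.leftInvOn_invFunOn (show i ∈ Set.Iic k from hi)]⟩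

variable {o d : V}

/-- A shortest bridge visits no vertex twice. -/
theorem IsBridge.injOn {β : V → ℝ} {k : ℕ} {w : ℕ → V} (h : N.IsBridge Set.univ o d β k w)
    (hmin : ∀ k' < k, ∀ w', ¬ N.IsBridge Set.univ o d β k' w') : Set.InjOn w (Set.Iic k) := by
  have key : ∀ i j, i < j → j ≤ k → w i ≠ w j := by
    intro i j hij hjk hw
    have hk : (if k - (j - i) ≤ i then w (k - (j - i)) else w (k - (j - i) + (j - i))) = w k := by
      by_cases hle : k - (j - i) ≤ i
      · have : j = k := by omega
        subst this
        have h2 : j - (j - i) = i := by omega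
        simp only [h2, le_refl, if_true, hw]
      · have h2 : k - (j - i) + (j - i) = k := by omega
        simp only [hle, if_false, h2]
    -- A repeated vertex `w i = w j` allows the steps from `i` to `j` to be cut out; `hk` also
    -- covers `j = k`, where the shortened walk ends at `w i`.
    refine hmin (k - (j - i)) (by omega) (fun n => if n ≤ i then w n else w (n + (j - i))) ?_
    constructor
    · rw [hk]
      simpa using h.ne
    · intro n hn
      by_cases h1 : n + 1 ≤ i
      · have h2 : n ≤ i := by omega
        simpa [h1, h2] using h.step n (by omega)
      · by_cases h2 : n ≤ i
        · have h3 : n = i := by omega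
          subst h3
          have h4 : n + 1 + (j - n) = j + 1 := by omega
          simpa [h4, hw] using h.step j (by omega)
        · have h4 : n + 1 + (j - i) = n + (j - i) + 1 := by omega
          simpa [h1, h2, h4] using h.step (n + (j - i)) (by omega)
    · intro n hn
      by_cases h1 : n ≤ i
      · simpa [h1] using h.level n (by omega)
      · simpa [h1] using h.level (n + (j - i)) (by omega)
    · simpa using h.left_in
    · simpa using h.left_out
    · rw [hk]
      exact h.right_in
    · rw [hk]
      exact h.right_out
  intro i hi j hj hij
  rcases lt_trichotomy i j with h1 | h1 | h1
  · exact absurd hij (key i j h1 hj)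
  · exact h1
  · exact absurd hij.symm (key j i h1 hi)

theorem reflTransGen_of_steps {r : V → V → Prop} {w : ℕ → V} {i j : ℕ} (hij : i ≤ j)
    (h : ∀ n, i ≤ n → n < j → r (w n) (w (n + 1))) : Relation.ReflTransGen r (w i) (w j) := by
  induction j, hij using Nat.le_induction with
  | base => exact .refl
  | succ j hj ih => exact (ih fun n h1 h2 => h n h1 (by omega)).tail (h j hj (by omega))

/-- If an inner vertex of a bridge can be reached from the origin along a strictly increasing walk,
there is a shorter bridge. -/
theorem IsBridge.shorten_of_in [Finite E] {β : V → ℝ} {k : ℕ} {w : ℕ → V}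
    (h : N.IsBridge Set.univ o d β k w) (hw : Set.InjOn w (Set.Iic k)) {i : ℕ} (h0 : 0 < i)
    (hi : i < k) (hin : Relation.ReflTransGen (N.Up Set.univ β) o (w i)) :
    ∃ β', N.IsBridge Set.univ o d β' i w := by
  -- The subtraction is truncated: the bridge stays level up to `w i` and rises from there to `w k`,
  -- which gives `w i` its increasing walk to `d`.
  obtain ⟨f, hf⟩ := exists_extension hw fun j => ((j - i : ℕ) : ℝ)
  obtain ⟨ε, hε, hup⟩ := exists_perturbation (N := N) β f
  have hm {x y : V} : Relation.ReflTransGen (N.Up Set.univ β) x y →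
      Relation.ReflTransGen (N.Up Set.univ fun x => β x + ε * f x) x y := by
    refine Relation.ReflTransGen.mono (fun x y hxy => ?_) _ _
    obtain ⟨e, he, rfl, rfl, hlt⟩ := hxy
    exact ⟨e, he, rfl, rfl, hup e hlt⟩
  refine ⟨fun x => β x + ε * f x, fun hc => ?_, fun j hj => h.step j (by omega), fun j hj => ?_,
    hm h.left_in, hm h.left_out, hm hin, ?_⟩
  · have := hw (Nat.zero_le k) hi.le hc
    omega
  · rw [hf j (by omega), hf 0 (by omega), h.level j (by omega)]
    simp [Nat.sub_eq_zero_of_le hj]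
  · refine (reflTransGen_of_steps hi.le fun n hn hnk => ?_).trans (hm h.right_out)
    obtain ⟨e, he, h1, h2⟩ := h.step n hnk
    refine ⟨e, he, h1, h2, ?_⟩
    dsimp only
    rw [hf n hnk.le, hf (n + 1) hnk, h.level n hnk.le, h.level (n + 1) hnk]
    have : n + 1 - i = n - i + 1 := by omega
    rw [this]
    push_cast
    linarith

/-- If the destination can be reached from an inner vertex of a bridge along a strictly increasing
walk, there is a shorter bridge. -/
theorem IsBridge.shorten_of_out [Finite E] {β : V → ℝ} {k : ℕ} {w : ℕ → V}
    (h : N.IsBridge Set.univ o d β k w) (hw : Set.InjOn w (Set.Iic k)) {i : ℕ}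
    (hi : i < k) (hout : Relation.ReflTransGen (N.Up Set.univ β) (w i) d) :
    ∃ β', N.IsBridge Set.univ o d β' (k - i) fun j => w (i + j) := by
  -- The bridge now rises from `w 0` to `w i`, which gives `w i` its increasing walk from `o`, and
  -- is level afterwards.
  obtain ⟨f, hf⟩ := exists_extension hw fun j => ((min j i : ℕ) : ℝ)
  obtain ⟨ε, hε, hup⟩ := exists_perturbation (N := N) β f
  have hm {x y : V} : Relation.ReflTransGen (N.Up Set.univ β) x y →
      Relation.ReflTransGen (N.Up Set.univ fun x => β x + ε * f x) x y := by
    refine Relation.ReflTransGen.mono (fun x y hxy => ?_) _ _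
    obtain ⟨e, he, rfl, rfl, hlt⟩ := hxy
    exact ⟨e, he, rfl, rfl, hup e hlt⟩
  have hik : i + (k - i) = k := by omega
  refine ⟨fun x => β x + ε * f x, fun hc => ?_, fun j hj => h.step (i + j) (by omega),
    fun j hj => ?_, ?_, hm hout, ?_, ?_⟩
  · rw [hik] at hc
    have := hw hi.le (le_refl k) hc
    omega
  · rw [hf (i + j) (by omega), hf (i + 0) (by omega), h.level (i + j) (by omega),
      h.level (i + 0) (by omega)]
    simp
  · refine (hm h.left_in).trans (reflTransGen_of_steps (Nat.zero_le i) fun n _ (hn : n < i) => ?_)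
    obtain ⟨e, he, h1, h2⟩ := h.step n (by omega)
    refine ⟨e, he, h1, h2, ?_⟩
    dsimp only
    rw [hf n (by omega), hf (n + 1) (by omega), h.level n (by omega), h.level (n + 1) (by omega),
      min_eq_left hn.le, min_eq_left (show n + 1 ≤ i from hn)]
    push_cast
    linarith
  · rw [hik]
    exact hm h.right_in
  · rw [hik]
    exact hm h.right_out

/-- Outside `F`, a higher out-neighbor forces a lower in-neighbor, so one can descend against the
edges until `F` or a known walk is reached; finiteness ends the descent. `Q` is inherited by lower
vertices and restricts the part of `F` where the descent can end. -/
theorem reaches_of_down [Finite V] {β : V → ℝ} {F : Set V}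
    (hF : ∀ x ∉ F, (∃ e, N.src e = x ∧ β x < β (N.tgt e)) →
      ∃ e, N.tgt e = x ∧ β (N.src e) < β x) {Q : V → Prop}
    (hQ : ∀ x y, β x < β y → Q y → Q x)
    (hFQ : ∀ x ∈ F, Q x → (∃ e, N.src e = x ∧ β x < β (N.tgt e)) →
      Relation.ReflTransGen (N.Up Set.univ β) o x) (x : V) (hx : Q x)
    (hout : ∃ e, N.src e = x ∧ β x < β (N.tgt e)) :
    Relation.ReflTransGen (N.Up Set.univ β) o x := by
  have hwf : WellFounded fun x y : V => β x < β y :=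
    (Finite.wellFounded_of_trans_of_irrefl (InvImage (· < ·) β))
  induction x using hwf.induction with
  | _ x ih =>
    by_cases hxF : x ∈ F
    · exact hFQ x hxF hx hout
    · obtain ⟨e, he, hlt⟩ := hF x hxF hout
      refine (ih _ hlt (hQ _ _ hlt hx) ⟨e, rfl, he ▸ hlt⟩).tail ⟨e, trivial, rfl, he, hlt⟩

theorem reaches_of_up [Finite V] {β : V → ℝ} {F : Set V}
    (hF : ∀ x ∉ F, (∃ e, N.tgt e = x ∧ β (N.src e) < β x) →
      ∃ e, N.src e = x ∧ β x < β (N.tgt e)) {Q : V → Prop}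
    (hQ : ∀ x y, β x < β y → Q x → Q y)
    (hFQ : ∀ x ∈ F, Q x → (∃ e, N.tgt e = x ∧ β (N.src e) < β x) →
      Relation.ReflTransGen (N.Up Set.univ β) x d) (x : V) (hx : Q x)
    (hin : ∃ e, N.tgt e = x ∧ β (N.src e) < β x) :
    Relation.ReflTransGen (N.Up Set.univ β) x d := by
  have hwf : WellFounded fun x y : V => β y < β x :=
    (Finite.wellFounded_of_trans_of_irrefl (InvImage (· > ·) β))
  induction x using hwf.induction with
  | _ x ih =>
    by_cases hxF : x ∈ F
    · exact hFQ x hxF hx hin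
    · obtain ⟨e, he, hlt⟩ := hF x hxF hin
      refine .head ⟨e, trivial, he, rfl, hlt⟩ (ih _ hlt (hQ _ _ hlt hx) ⟨e, rfl, he ▸ hlt⟩)

/-- A graph with a bridge has a bridge for a function such that all edges along which it increases
strictly are part of strictly increasing walks from the origin to the destination. -/
theorem HasBridge.exists_complete [Finite V] [Finite E]
    (hV : ∀ x, x ≠ o → x ≠ d → (∃ e, N.src e = x ∨ N.tgt e = x) →
      (∃ e, N.tgt e = x) ∧ ∃ e, N.src e = x) (h : N.HasBridge Set.univ o d) :
    ∃ β k w, N.IsBridge Set.univ o d β k w ∧ ∀ e, β (N.src e) < β (N.tgt e) →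
      Relation.ReflTransGen (N.Up Set.univ β) o (N.src e) ∧
      Relation.ReflTransGen (N.Up Set.univ β) (N.tgt e) d := by
  classical
  -- The length is minimized over all functions β at once, because shortening a bridge changes β.
  have hex : ∃ k β w, N.IsBridge Set.univ o d β k w := by
    obtain ⟨β, k, w, hw⟩ := h
    exact ⟨k, β, w, hw⟩
  have hmin : ∀ k' < Nat.find hex, ∀ β w, ¬ N.IsBridge Set.univ o d β k' w :=
    fun k' hk' β w hc => Nat.find_min hex hk' ⟨β, w, hc⟩
  obtain ⟨β₀, w, hw⟩ := Nat.find_spec hex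
  set k := Nat.find hex
  have hinj := hw.injOn fun k' hk' => hmin k' hk' β₀
  set U : Set V := {x | Relation.ReflTransGen (N.Up Set.univ β₀) o x ∧
    Relation.ReflTransGen (N.Up Set.univ β₀) x d} with hU
  set F : Set V := U ∪ {x | ∃ i ≤ k, w i = x} with hF
  -- Vertices of `I` outside `F` have no edges at all, by `hV` and because `o` and `d` lie in `U`;
  -- prescribing β there is harmless.
  set I : Set V := {x | ¬ ((∃ e, N.tgt e = x) ∧ ∃ e, N.src e = x)} with hI
  obtain ⟨β, hβF, hβ⟩ := exists_balanced (N := N) β₀ (F ∪ I) fun x hx => by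
    by_contra hc
    exact hx (Or.inr hc)
  have hod : Relation.ReflTransGen (N.Up Set.univ β₀) o d := hw.left_in.trans hw.left_out
  have hβ' : ∀ x ∉ F, (∃ e, N.tgt e = x ∧ β (N.src e) < β x) ↔
      ∃ e, N.src e = x ∧ β x < β (N.tgt e) := by
    intro x hx
    by_cases hxI : x ∈ I
    · have hno : ¬ ∃ e, N.src e = x ∨ N.tgt e = x := fun hc =>
        hxI (hV x (fun h => hx (Or.inl (h ▸ ⟨.refl, hod⟩)))
          (fun h => hx (Or.inl (h ▸ ⟨hod, .refl⟩))) hc)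
      exact ⟨fun ⟨e, he, _⟩ => absurd ⟨e, Or.inr he⟩ hno,
        fun ⟨e, he, _⟩ => absurd ⟨e, Or.inl he⟩ hno⟩
    · exact hβ x fun hc => hc.elim hx hxI
  have hlt : ∀ x ∈ F, ∀ y ∈ F, β₀ x < β₀ y → β x < β y := by
    intro x hx y hy h
    rw [hβF x (Or.inl hx), hβF y (Or.inl hy)]
    exact Real.exp_lt_exp.2 h
  have hin : ∀ x, Relation.ReflTransGen (N.Up Set.univ β₀) o x →
      Relation.ReflTransGen (N.Up Set.univ β₀) x d →
      Relation.ReflTransGen (N.Up Set.univ β) o x := by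
    intro x hx
    induction hx with
    | refl => exact fun _ => .refl
    | tail hox hxy ih =>
      intro hyd
      have hxd := Relation.ReflTransGen.head hxy hyd
      have hoy := Relation.ReflTransGen.tail hox hxy
      obtain ⟨e, -, rfl, rfl, hl⟩ := hxy
      exact (ih hxd).tail ⟨e, trivial, rfl, rfl,
        hlt _ (Or.inl ⟨hox, hxd⟩) _ (Or.inl ⟨hoy, hyd⟩) hl⟩
  have hout : ∀ x, Relation.ReflTransGen (N.Up Set.univ β₀) x d →
      Relation.ReflTransGen (N.Up Set.univ β₀) o x →
      Relation.ReflTransGen (N.Up Set.univ β) x d := by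
    intro x hx
    induction hx using Relation.ReflTransGen.head_induction_on with
    | refl => exact fun _ => .refl
    | head hxy hyd ih =>
      intro hox
      have hoy := hox.tail hxy
      have hxd := Relation.ReflTransGen.head hxy hyd
      obtain ⟨e, -, rfl, rfl, hl⟩ := hxy
      exact .head ⟨e, trivial, rfl, rfl,
        hlt _ (Or.inl ⟨hox, hxd⟩) _ (Or.inl ⟨hoy, hyd⟩) hl⟩ (ih hoy)
  have hwF : ∀ i ≤ k, w i ∈ F := fun i hi => Or.inr ⟨i, hi, rfl⟩
  have hlevel : ∀ i ≤ k, β (w i) = β (w 0) := fun i hi => by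
    rw [hβF _ (Or.inl (hwF i hi)), hβF _ (Or.inl (hwF 0 (Nat.zero_le _))), hw.level i hi]
  have hbr : N.IsBridge Set.univ o d β k w :=
    ⟨hw.ne, hw.step, hlevel, hin _ hw.left_in hw.left_out, hout _ hw.left_out hw.left_in,
      hin _ hw.right_in hw.right_out, hout _ hw.right_out hw.right_in⟩
  have hUw : ∀ x ∈ F, x ∈ U ∨ ∃ i, 0 < i ∧ i < k ∧ w i = x := by
    rintro x (hx | ⟨i, hi, rfl⟩)
    · exact Or.inl hx
    · rcases Nat.eq_zero_or_pos i with rfl | h0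
      · exact Or.inl ⟨hw.left_in, hw.left_out⟩
      · rcases hi.eq_or_lt with rfl | hi
        · exact Or.inl ⟨hw.right_in, hw.right_out⟩
        · exact Or.inr ⟨i, h0, hi, rfl⟩
  -- the inner vertices of the bridge have no strictly increasing edges
  have hno_in : ∀ i, 0 < i → i < k → ¬ ∃ e, N.tgt e = w i ∧ β (N.src e) < β (w i) := by
    rintro i h0 hi ⟨e, he, hl⟩
    -- Strictly below the level of the bridge, all vertices of `F` lie in `U`. So an increasing edge
    -- into `w i` would make `w i` reachable from `o`, and the bridge could be shortened.
    have := reaches_of_down (o := o) (fun x hx => (hβ' x hx).2) (Q := fun x => β x < β (w 0))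
      (fun x y hxy hy => hxy.trans hy) (fun x hx hxc _ => ?_) (N.src e)
      (by rwa [hlevel i hi.le] at hl) ⟨e, rfl, by rwa [he]⟩
    · obtain ⟨β', hβ'⟩ := hbr.shorten_of_in hinj h0 hi (this.tail ⟨e, trivial, rfl, he, hl⟩)
      exact hmin i hi β' w hβ'
    · rcases hUw x hx with hx | ⟨j, -, hj, rfl⟩
      · exact hin x hx.1 hx.2
      · exact absurd (hlevel j hj.le) hxc.ne
  have hno_out : ∀ i, 0 < i → i < k → ¬ ∃ e, N.src e = w i ∧ β (w i) < β (N.tgt e) := by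
    rintro i h0 hi ⟨e, he, hl⟩
    have := reaches_of_up (d := d) (fun x hx => (hβ' x hx).1) (Q := fun x => β (w 0) < β x)
      (fun x y hxy hx => lt_trans hx hxy) (fun x hx hxc _ => ?_) (N.tgt e)
      (by rwa [hlevel i hi.le] at hl) ⟨e, rfl, by rwa [he]⟩
    · obtain ⟨β', hβ'⟩ := hbr.shorten_of_out hinj hi (.head ⟨e, trivial, he, rfl, hl⟩ this)
      exact hmin (k - i) (by omega) β' _ hβ'
    · rcases hUw x hx with hx | ⟨j, -, hj, rfl⟩
      · exact hout x hx.2 hx.1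
      · exact absurd (hlevel j hj.le) hxc.ne'
  refine ⟨β, k, w, hbr, fun e he => ⟨?_, ?_⟩⟩
  · refine reaches_of_down (fun x hx => (hβ' x hx).2) (Q := fun _ => True)
      (fun _ _ _ _ => trivial) (fun x hx _ hxo => ?_) (N.src e) trivial ⟨e, rfl, he⟩
    rcases hUw x hx with hx | ⟨j, h0, hj, rfl⟩
    · exact hin x hx.1 hx.2
    · exact absurd hxo (hno_out j h0 hj)
  · refine reaches_of_up (fun x hx => (hβ' x hx).1) (Q := fun _ => True)
      (fun _ _ _ _ => trivial) (fun x hx _ hxo => ?_) (N.tgt e) trivial ⟨e, rfl, he⟩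
    rcases hUw x hx with hx | ⟨j, h0, hj, rfl⟩
    · exact hout x hx.2 hx.1
    · exact absurd hxo (hno_in j h0 hj)

end Balancing

end ODGraph

namespace RoutingGame

/-! ### Uniqueness of equilibrium loads -/

section Equilibrium

variable {V E : Type*} {N : Network V E} {T : Type*} [MeasurableSpace T] (G : RoutingGame N T)

theorem expectedCost_eq_sum [Fintype T] [DiscreteMeasurableSpace T] (p : Measure T)
    [IsProbabilityMeasure p] (e : E) (x : ℝ) :
    G.expectedCost p e x = ∑ θ, p.real {θ} * G.cost e θ x := by
  rw [expectedCost, integral_fintype .of_finite]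
  simp [smul_eq_mul]

theorem expectedCost_strictMonoOn [Fintype T] [DiscreteMeasurableSpace T] (p : Measure T)
    [IsProbabilityMeasure p] (e : E) :
    StrictMonoOn (G.expectedCost p e) (Rco (G.capacity e)) := by
  intro x hx y hy hxy
  rw [expectedCost_eq_sum, expectedCost_eq_sum]
  have hsum : ∑ θ, p.real {θ} = 1 := by
    rw [sum_measureReal_singleton]
    simp
  obtain ⟨θ, -, hθ⟩ : ∃ θ ∈ Finset.univ, p.real {θ} ≠ 0 := by
    apply Finset.exists_ne_zero_of_sum_ne_zero
    rw [hsum]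
    exact one_ne_zero
  refine Finset.sum_lt_sum (fun θ _ => ?_) ⟨θ, Finset.mem_univ _, ?_⟩
  · exact mul_le_mul_of_nonneg_left (G.cost_strictMonoOn e θ hx hy hxy).le measureReal_nonneg
  · exact mul_lt_mul_of_pos_left (G.cost_strictMonoOn e θ hx hy hxy)
      (lt_of_le_of_ne measureReal_nonneg hθ.symm)

variable [Fintype E] {G} {p : Measure T} {d : ℝ} {y y' : N.ODPath → ℝ}

theorem load_nonneg (hy : ∀ r, 0 ≤ y r) (e : E) : 0 ≤ G.load y e :=
  Finset.sum_nonneg fun r _ => hy r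

theorem le_load (hy : ∀ r, 0 ≤ y r) {r : N.ODPath} {e : E} (he : e ∈ r.1) : y r ≤ G.load y e := by
  classical
  exact Finset.single_le_sum (f := y) (fun r _ => hy r) (by simpa using he)

/-- Turns the pairing of path costs with path flows into one of edge costs with edge loads, where
strict monotonicity of the costs applies. -/
theorem sum_pathCost_mul (y z : N.ODPath → ℝ) :
    ∑ r, G.pathCost p y r * z r = ∑ e, G.expectedCost p e (G.load y e) * G.load z e := by
  classical
  simp only [pathCost, load, Finset.sum_filter, Finset.sum_mul, Finset.mul_sum]
  rw [Finset.sum_comm]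
  refine Finset.sum_congr rfl fun e _ => Finset.sum_congr rfl fun r _ => ?_
  split_ifs <;> simp

/-- The variational inequality that characterizes Wardrop equilibria. -/
theorem IsWardrop.sum_le (h : G.IsWardrop p d y) (h' : G.IsFeasible d y') :
    ∑ r, G.pathCost p y r * y r ≤ ∑ r, G.pathCost p y r * y' r := by
  have := N.exists_path
  obtain ⟨r₀, hr₀⟩ := Finite.exists_min (G.pathCost p y)
  have h1 : ∀ r, G.pathCost p y r * y r = G.pathCost p y r₀ * y r := by
    intro r
    rcases (h.1.1 r).eq_or_lt with hr | hr
    · simp [← hr]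
    · rw [le_antisymm (h.2 r r₀ hr) (hr₀ r)]
  calc ∑ r, G.pathCost p y r * y r = G.pathCost p y r₀ * d := by
        simp only [h1, ← Finset.mul_sum, h.1.2.1]
    _ = ∑ r, G.pathCost p y r₀ * y' r := by rw [← Finset.mul_sum, h'.2.1]
    _ ≤ _ := Finset.sum_le_sum fun r _ => mul_le_mul_of_nonneg_right (hr₀ r) (h'.1 r)

/-- All Wardrop equilibria induce the same loads. -/
theorem IsWardrop.load_unique [Fintype T] [DiscreteMeasurableSpace T] [IsProbabilityMeasure p]
    (h : G.IsWardrop p d y)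
    (h' : G.IsWardrop p d y') : G.load y = G.load y' := by
  have h1 := h.sum_le h'.1
  have h2 := h'.sum_le h.1
  simp only [sum_pathCost_mul] at h1 h2
  have hmem : ∀ {z}, G.IsFeasible d z → ∀ e, G.load z e ∈ Rco (G.capacity e) := fun hz e =>
    ⟨load_nonneg hz.1 e, hz.2.2 e⟩
  have hterm : ∀ e, 0 ≤ (G.expectedCost p e (G.load y e) - G.expectedCost p e (G.load y' e)) *
      (G.load y e - G.load y' e) := by
    intro e
    have hm := (G.expectedCost_strictMonoOn p e).monotoneOn
    rcases le_total (G.load y e) (G.load y' e) with hle | hle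
    · exact mul_nonneg_of_nonpos_of_nonpos (sub_nonpos.2 (hm (hmem h.1 e) (hmem h'.1 e) hle))
        (sub_nonpos.2 hle)
    · exact mul_nonneg (sub_nonneg.2 (hm (hmem h'.1 e) (hmem h.1 e) hle)) (sub_nonneg.2 hle)
  -- The sum of the variational inequalities of the two equilibria; together with `hterm` it makes
  -- every term zero.
  have hsum : ∑ e, (G.expectedCost p e (G.load y e) - G.expectedCost p e (G.load y' e)) *
      (G.load y e - G.load y' e) ≤ 0 := by
    have : ∑ e, (G.expectedCost p e (G.load y e) - G.expectedCost p e (G.load y' e)) *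
        (G.load y e - G.load y' e) =
        (∑ e, G.expectedCost p e (G.load y e) * G.load y e -
          ∑ e, G.expectedCost p e (G.load y e) * G.load y' e) +
        (∑ e, G.expectedCost p e (G.load y' e) * G.load y' e -
          ∑ e, G.expectedCost p e (G.load y' e) * G.load y e) := by
      simp only [← Finset.sum_sub_distrib, ← Finset.sum_add_distrib]
      exact Finset.sum_congr rfl fun e _ => by ring
    linarith
  have hzero := (Finset.sum_eq_zero_iff_of_nonneg fun e _ => hterm e).1
    (le_antisymm hsum (Finset.sum_nonneg fun e _ => hterm e))
  funext e
  rcases mul_eq_zero.1 (hzero e (Finset.mem_univ _)) with h0 | h0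
  · exact (G.expectedCost_strictMonoOn p e).injOn (hmem h.1 e) (hmem h'.1 e) (sub_eq_zero.1 h0)
  · exact sub_eq_zero.1 h0

theorem IsWardrop.eqLoad_eq [Fintype T] [DiscreteMeasurableSpace T] [IsProbabilityMeasure p]
    (h : G.IsWardrop p d y) :
    G.eqLoad p d = G.load y := by
  have hex : ∃ y, G.IsWardrop p d y := ⟨y, h⟩
  rw [eqLoad, dif_pos hex]
  exact hex.choose_spec.load_unique h

theorem pathCost_eq_sum (y : N.ODPath → ℝ) (r : N.ODPath) :
    G.pathCost p y r = (r.1.map fun e => G.expectedCost p e (G.load y e)).sum := by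
  classical
  rw [pathCost, ← List.sum_toFinset _ (ODGraph.IsPath.nodup r.2)]
  refine Finset.sum_congr ?_ fun _ _ => rfl
  ext e
  simp

end Equilibrium

end RoutingGame

/-! ### Telescoping sums, and walks built from increasing or level steps -/

namespace ODGraph

variable {V E : Type*} {N : ODGraph V E}

theorem IsWalk.sum_sub {l : List E} {v u : V} (h : N.IsWalk l v u) (π : V → ℝ) :
    (l.map fun e => π (N.tgt e) - π (N.src e)).sum = π u - π v := by
  induction l generalizing v with
  | nil =>
    have : v = u := h
    simp [this]
  | cons e l ih =>
    rw [List.map_cons, List.sum_cons, ih h.2, h.1]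
    ring

theorem exists_isWalk_of_reflTransGen_up {A : Set E} {β : V → ℝ} {x y : V}
    (h : Relation.ReflTransGen (N.Up A β) x y) :
    ∃ l, N.IsWalk l x y ∧ ∀ e ∈ l, β (N.src e) < β (N.tgt e) := by
  induction h using Relation.ReflTransGen.head_induction_on with
  | refl => exact ⟨[], rfl, by simp⟩
  | head hxy _ ih =>
    obtain ⟨e, -, rfl, rfl, hlt⟩ := hxy
    obtain ⟨l, hl, hβ⟩ := ih
    exact ⟨e :: l, ⟨rfl, hl⟩, by simpa using ⟨hlt, hβ⟩⟩

theorem exists_isWalk_of_seq {w : ℕ → V} {P : E → Prop} {k : ℕ}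
    (h : ∀ i < k, ∃ e, P e ∧ N.src e = w i ∧ N.tgt e = w (i + 1)) :
    ∃ l, N.IsWalk l (w 0) (w k) ∧ ∀ e ∈ l, P e := by
  induction k with
  | zero => exact ⟨[], rfl, by simp⟩
  | succ k ih =>
    obtain ⟨l, hl, hP⟩ := ih fun i hi => h i (by omega)
    obtain ⟨e, he, h1, h2⟩ := h k (by omega)
    refine ⟨l ++ [e], hl.append ⟨h1, h2⟩, fun f hf => ?_⟩
    rcases List.mem_append.1 hf with hf | hf
    · exact hP f hf
    · rw [List.mem_singleton.1 hf]
      exact he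

/-- A strictly increasing walk is a path. -/
theorem IsWalk.isPath_of_increasing {β : V → ℝ} {l : List E} {v u : V} (h : N.IsWalk l v u)
    (hβ : ∀ e ∈ l, β (N.src e) < β (N.tgt e)) : N.IsPath l v u := by
  have hle : ∀ (l : List E) (v : V), N.IsWalk l v u → (∀ e ∈ l, β (N.src e) < β (N.tgt e)) →
      ∀ x ∈ N.support v l, β v ≤ β x := by
    intro l
    induction l with
    | nil =>
      intro v _ _ x hx
      have : x = v := by simpa [support] using hx
      rw [this]
    | cons e l ih =>
      intro v hw hl x hx
      rcases List.mem_cons.1 hx with rfl | hx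
      · exact le_rfl
      · have h1 := ih _ hw.2 (fun f hf => hl f (by simp [hf])) x hx
        have h2 := hl e (by simp)
        rw [hw.1] at h2
        exact h2.le.trans h1
  induction l generalizing v with
  | nil => exact ⟨h, by simp⟩
  | cons e l ih =>
    have hl : ∀ f ∈ l, β (N.src f) < β (N.tgt f) := fun f hf => hβ f (by simp [hf])
    refine IsPath.cons_iff.2 ⟨h.1, fun hc => ?_, ih h.2 hl⟩
    have h1 := hle l _ h.2 hl v hc
    have h2 := hβ e (by simp)
    rw [h.1] at h2
    exact absurd h1 (not_le.2 h2)

end ODGraph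

namespace RoutingGame

/-! ### Potentials and path costs -/

section Potential

variable {V E : Type*} [Fintype E] {N : Network V E}
  {T : Type*} [MeasurableSpace T]
  {G : RoutingGame N T} {p : Measure T} {d : ℝ} {y : N.ODPath → ℝ}

theorem pathCost_eq_of_potential (π : V → ℝ) (r : N.ODPath)
    (h : ∀ e ∈ r.1, G.expectedCost p e (G.load y e) = π (N.tgt e) - π (N.src e)) :
    G.pathCost p y r = π N.dest - π N.origin := by
  rw [pathCost_eq_sum, ← r.2.1.sum_sub π]
  exact congrArg List.sum (List.map_congr_left h)

/-- A flow is an equilibrium if the cost of each edge is at least the difference of a potential,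
with equality for the edges in use. -/
theorem isWardrop_of_potential (hy : G.IsFeasible d y) (π : V → ℝ)
    (hle : ∀ e, π (N.tgt e) - π (N.src e) ≤ G.expectedCost p e (G.load y e))
    (heq : ∀ r, 0 < y r → ∀ e ∈ r.1,
      G.expectedCost p e (G.load y e) = π (N.tgt e) - π (N.src e)) :
    G.IsWardrop p d y := by
  refine ⟨hy, fun r r' hr => ?_⟩
  rw [pathCost_eq_of_potential π r (heq r hr), pathCost_eq_sum, ← r'.2.1.sum_sub π]
  exact List.sum_le_sum fun e _ => hle e

/-- The cost of a used path is at most the cost of any walk. -/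
theorem IsWardrop.pathCost_le_walk (h : G.IsWardrop p d y)
    (hnn : ∀ e, 0 ≤ G.expectedCost p e (G.load y e)) {r : N.ODPath} (hr : 0 < y r) {l : List E}
    (hl : N.IsWalk l N.origin N.dest) :
    G.pathCost p y r ≤ (l.map fun e => G.expectedCost p e (G.load y e)).sum := by
  obtain ⟨l', hl', hs⟩ := hl.exists_isPath
  refine (h.2 r ⟨l', hl'⟩ hr).trans ((pathCost_eq_sum y _).trans_le ?_)
  refine (hs.map _).sum_le_sum fun c hc => ?_
  obtain ⟨e, -, rfl⟩ := List.mem_map.1 hc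
  exact hnn e

end Potential

/-! ### Affine games with two states -/

section Affine

variable {V E : Type*} {N : Network V E}

/-- The game with two equally likely states, infinite capacities and affine cost functions. -/
noncomputable def affineGame (N : Network V E) (a : E → Fin 2 → ℝ) (b : E → ℝ)
    (ha : ∀ e θ, 0 ≤ a e θ) (hb : ∀ e, 0 < b e) (hne : ∃ e, a e 0 ≠ a e 1) :
    RoutingGame N (Fin 2) where
  capacity _ := ⊤
  capacity_pos _ := ENNReal.zero_lt_top
  cost e θ x := a e θ + b e * x
  cost_nonneg e θ x hx := add_nonneg (ha e θ) (mul_nonneg (hb e).le hx.1)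
  cost_continuousOn e θ := by fun_prop
  cost_strictMonoOn e θ x _ y _ hxy := by
    have := mul_lt_mul_of_pos_left hxy (hb e)
    dsimp only
    linarith
  identifiable θ θ' h := by
    obtain ⟨e, he⟩ := hne
    refine ⟨e, 0, ⟨le_rfl, by simp⟩, ?_⟩
    fin_cases θ <;> fin_cases θ' <;> simp_all [eq_comm]
  prior := (PMF.uniformOfFintype (Fin 2)).toMeasure

variable {a : E → Fin 2 → ℝ} {b : E → ℝ} {ha : ∀ e θ, 0 ≤ a e θ} {hb : ∀ e, 0 < b e}
  {hne : ∃ e, a e 0 ≠ a e 1}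

theorem affineGame_hasUnboundedCosts : (affineGame N a b ha hb hne).HasUnboundedCosts := by
  intro e θ M
  refine ⟨max 0 (M / b e), ⟨le_max_left _ _, ENNReal.ofReal_lt_top⟩, fun x _ hx => ?_⟩
  have h1 : M ≤ b e * x := by
    have := (le_max_right _ _).trans hx
    rwa [div_le_iff₀' (hb e)] at this
  have := ha e θ
  change M ≤ a e θ + b e * x
  linarith

theorem affineGame_networkCapacity [Fintype E] :
    (affineGame N a b ha hb hne).networkCapacity = ⊤ := by
  rw [networkCapacity]
  refine iInf_eq_top.2 fun C => iInf_eq_top.2 fun hC => ?_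
  obtain ⟨r⟩ := N.exists_path
  obtain ⟨e, -, he⟩ := hC r
  exact ENNReal.sum_eq_top.2 ⟨e, he, rfl⟩

theorem affineGame_prior_real (θ : Fin 2) :
    (affineGame N a b ha hb hne).prior.real {θ} = 1 / 2 := by
  change (PMF.uniformOfFintype (Fin 2)).toMeasure.real {θ} = _
  rw [Measure.real, PMF.toMeasure_apply_singleton _ _ (MeasurableSet.singleton _)]
  simp

theorem affineGame_expectedCost_prior [Fintype E] (e : E) (x : ℝ) :
    (affineGame N a b ha hb hne).expectedCost (affineGame N a b ha hb hne).prior e x =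
      (a e 0 + a e 1) / 2 + b e * x := by
  rw [expectedCost_eq_sum]
  simp only [affineGame_prior_real, Fin.sum_univ_two]
  change 1 / 2 * (a e 0 + b e * x) + 1 / 2 * (a e 1 + b e * x) = _
  ring

theorem affineGame_expectedCost_dirac (θ : Fin 2) (e : E) (x : ℝ) :
    (affineGame N a b ha hb hne).expectedCost (Measure.dirac θ) e x = a e θ + b e * x := by
  rw [expectedCost, integral_dirac]
  rfl

/-- A Wardrop equilibrium in complete information: a minimizer of the Beckmann potential. -/
theorem affineGame_exists_isWardrop [Fintype E] (θ : Fin 2) {d : ℝ} (hd : 0 ≤ d) :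
    ∃ y, (affineGame N a b ha hb hne).IsWardrop (Measure.dirac θ) d y := by
  classical
  set G := affineGame N a b ha hb hne with hG
  have := N.exists_path
  let K : Set (N.ODPath → ℝ) := {y | (∀ r, 0 ≤ y r) ∧ ∑ r, y r = d}
  have hK : IsCompact K := by
    have hclosed : IsClosed K := by
      have h1 : IsClosed {y : N.ODPath → ℝ | ∀ r, 0 ≤ y r} := by
        simp only [Set.ofPred_forall]
        exact isClosed_iInter fun r => isClosed_le continuous_const (continuous_apply r)
      exact h1.inter (isClosed_eq (by fun_prop) continuous_const)
    refine (isCompact_univ_pi fun _ : N.ODPath =>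
      isCompact_Icc (a := (0 : ℝ)) (b := d)).of_isClosed_subset hclosed fun y hy r _ => ⟨hy.1 r, ?_⟩
    rw [← hy.2]
    exact Finset.single_le_sum (f := y) (fun r _ => hy.1 r) (Finset.mem_univ r)
  have hne' : K.Nonempty := by
    refine ⟨fun r => if r = Classical.arbitrary _ then d else 0, fun r => ?_, by simp⟩
    dsimp only
    split_ifs
    · exact hd
    · exact le_rfl
  let Φ : (N.ODPath → ℝ) → ℝ := fun y => ∑ e, (a e θ * G.load y e + b e / 2 * G.load y e ^ 2)
  have hΦ : Continuous Φ := by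
    simp only [Φ, load]
    fun_prop
  obtain ⟨y, hyK, hmin⟩ := hK.exists_isMinOn hne' hΦ.continuousOn
  refine ⟨y, ⟨hyK.1, hyK.2, fun e => ENNReal.ofReal_lt_top⟩, fun r r' hr => ?_⟩
  -- shifting a small amount of flow from `r` to `r'` does not lower the potential
  set D : E → ℝ := fun e => (if e ∈ r'.1 then 1 else 0) - (if e ∈ r.1 then 1 else 0) with hD
  have hA : ∑ e, (a e θ + b e * G.load y e) * D e =
      G.pathCost (Measure.dirac θ) y r' - G.pathCost (Measure.dirac θ) y r := by
    simp only [pathCost, hG, affineGame_expectedCost_dirac, Finset.sum_filter, hD, mul_sub,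
      Finset.sum_sub_distrib, mul_ite, mul_one, mul_zero]
  set A := ∑ e, (a e θ + b e * G.load y e) * D e
  set B := ∑ e, b e / 2 * D e ^ 2
  have hB : 0 ≤ B := Finset.sum_nonneg fun e _ => mul_nonneg (half_pos (hb e)).le (sq_nonneg _)
  have hkey : ∀ t, 0 ≤ t → t ≤ y r → 0 ≤ t * A + t ^ 2 * B := by
    intro t ht0 ht
    set z : N.ODPath → ℝ := fun s =>
      y s + t * ((if s = r' then 1 else 0) - (if s = r then 1 else 0)) with hz
    have hzK : z ∈ K := by
      refine ⟨fun s => ?_, ?_⟩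
      · have := hyK.1 s
        simp only [hz]
        split_ifs with h1 h2 h2
        · linarith
        · linarith
        · rw [h2]
          linarith
        · linarith
      · simp [hz, Finset.sum_add_distrib, ← Finset.mul_sum, hyK.2]
    have hload : ∀ e, G.load z e = G.load y e + t * D e := by
      intro e
      simp [load, hz, hD, Finset.sum_add_distrib, ← Finset.mul_sum, Finset.sum_ite_eq']
    have hle : Φ y ≤ Φ z := hmin hzK
    have hdiff : Φ z - Φ y = t * A + t ^ 2 * B := by
      simp only [Φ, A, B, Finset.mul_sum, ← Finset.sum_sub_distrib, ← Finset.sum_add_distrib, hload]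
      exact Finset.sum_congr rfl fun e _ => by ring
    linarith
  by_contra hlt
  have hA0 : A < 0 := by
    rw [hA]
    linarith
  -- With `t * (B + 1) ≤ -A`, the change `t * A + t ^ 2 * B` of the potential is at most `-t ^ 2`,
  -- which is negative.
  set t := min (y r) (-A / (B + 1)) with ht
  have ht0 : 0 < t := lt_min hr (div_pos (neg_pos.2 hA0) (by linarith))
  have h1 : t * (B + 1) ≤ -A := by
    rw [← le_div_iff₀ (by linarith)]
    exact min_le_right _ _
  have h2 := hkey t ht0.le (min_le_left _ _)
  nlinarith

end Affine

end RoutingGame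

/-! ### The game on a network with a bridge -/

theorem Network.isNet {V E : Type*} (N : Network V E) :
    N.IsNet Set.univ N.origin N.dest := by
  refine ⟨N.origin_ne_dest, ?_, fun e _ => ?_⟩
  · obtain ⟨r⟩ := N.exists_path
    rcases r.2.1.src_mem_or_eq with h | ⟨e, -, -⟩
    · exact absurd h N.origin_ne_dest
    · exact ⟨e, trivial⟩
  · obtain ⟨r, hr⟩ := N.edge_mem_path e
    exact ⟨r.1, ⟨r.2, fun _ _ => trivial⟩, hr⟩

theorem Network.exists_in_and_out {V E : Type*} (N : Network V E) (x : V) (hxo : x ≠ N.origin)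
    (hxd : x ≠ N.dest) (hx : ∃ e, N.src e = x ∨ N.tgt e = x) :
    (∃ e, N.tgt e = x) ∧ ∃ e, N.src e = x := by
  obtain ⟨e, he⟩ := hx
  obtain ⟨r, hr⟩ := N.edge_mem_path e
  have hmem : x ∈ N.support N.origin r.1 := by
    rcases he with rfl | rfl
    · exact r.2.1.src_mem_support hr
    · exact ODGraph.tgt_mem_support hr
  constructor
  · rcases ODGraph.mem_support.1 hmem with h | ⟨f, -, h⟩
    · exact absurd h hxo
    · exact ⟨f, h⟩
  · rcases r.2.1.mem_support_iff.1 hmem with h | ⟨f, -, h⟩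
    · exact absurd h hxd
    · exact ⟨f, h⟩

namespace RoutingGame

variable {V E : Type*} [Fintype E]

/-- On a network with a bridge there is a game in which the prior keeps the flow away from all
edges with unknown costs, whatever the demand, but in state `1` the loads are different for each
positive demand. -/
theorem exists_affineGame [Finite V] (N : Network V E)
    (hN : N.HasBridge Set.univ N.origin N.dest) :
    ∃ (a : E → Fin 2 → ℝ) (b : E → ℝ) (ha : ∀ e θ, 0 ≤ a e θ) (hb : ∀ e, 0 < b e)
      (hne : ∃ e, a e 0 ≠ a e 1) (x : E → ℝ),
      (∀ e, 0 ≤ x e) ∧ (∀ e, 0 < x e → a e 0 = a e 1) ∧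
      (∀ d, 0 ≤ d → (affineGame N a b ha hb hne).eqLoad (affineGame N a b ha hb hne).prior d =
        fun e => d * x e) ∧
      ∀ d, 0 < d → (affineGame N a b ha hb hne).eqLoad (Measure.dirac 1) d ≠ fun e => d * x e := by
  classical
  obtain ⟨β, k, w, hw, hcomplete⟩ := hN.exists_complete N.exists_in_and_out
  set S : E → Prop := fun e => β (N.src e) < β (N.tgt e) with hS
  -- the flow that is uniform on the paths in `S`
  set R : Finset N.ODPath := Finset.univ.filter fun r => ∀ e ∈ r.1, S e with hR
  have hR_mem : ∀ {r}, r ∈ R ↔ ∀ e ∈ r.1, S e := fun {r} => by simp [hR]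
  have hSR : ∀ e, S e → ∃ r ∈ R, e ∈ r.1 := by
    intro e he
    obtain ⟨h1, h2⟩ := hcomplete e he
    obtain ⟨l₁, hl₁, hβ₁⟩ := ODGraph.exists_isWalk_of_reflTransGen_up h1
    obtain ⟨l₂, hl₂, hβ₂⟩ := ODGraph.exists_isWalk_of_reflTransGen_up h2
    have hwalk : N.IsWalk (l₁ ++ e :: l₂) N.origin N.dest := hl₁.append ⟨rfl, hl₂⟩
    have hβ : ∀ f ∈ l₁ ++ e :: l₂, β (N.src f) < β (N.tgt f) := by
      intro f hf
      rcases List.mem_append.1 hf with hf | hf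
      · exact hβ₁ f hf
      · rcases List.mem_cons.1 hf with rfl | hf
        · exact he
        · exact hβ₂ f hf
    exact ⟨⟨_, hwalk.isPath_of_increasing hβ⟩, hR_mem.2 hβ, by simp⟩
  have hRne : R.Nonempty := by
    obtain ⟨l, hl, hβ⟩ := ODGraph.exists_isWalk_of_reflTransGen_up (hw.left_in.trans hw.left_out)
    exact ⟨⟨l, hl.isPath_of_increasing hβ⟩, hR_mem.2 hβ⟩
  have hRc : (0 : ℝ) < R.card := by exact_mod_cast hRne.card_pos
  set x : E → ℝ := fun e => (R.filter fun r => e ∈ r.1).card / R.card with hx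
  have hxS : ∀ e, S e → 0 < x e := by
    intro e he
    obtain ⟨r, hr, her⟩ := hSR e he
    refine div_pos ?_ hRc
    exact_mod_cast Finset.card_pos.2 ⟨r, Finset.mem_filter.2 ⟨hr, her⟩⟩
  have hx0 : ∀ e, ¬ S e → x e = 0 := by
    intro e he
    have : (R.filter fun r => e ∈ r.1) = ∅ :=
      Finset.filter_eq_empty_iff.2 fun r hr her => he (hR_mem.1 hr e her)
    simp [hx, this]
  set u := w 0
  set v := w k
  have huv : β v = β u := hw.level k le_rfl
  -- `K` is so large that the constant cost of an edge in `S` stays nonnegative even where the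
  -- indicator of `v` drops by 1.
  obtain ⟨K, hK⟩ : ∃ K : ℝ, ∀ e, S e → 1 ≤ K * (β (N.tgt e) - β (N.src e)) := by
    obtain ⟨K, hK⟩ := (Set.finite_range fun e => 1 / (β (N.tgt e) - β (N.src e))).bddAbove
    refine ⟨K, fun e he => ?_⟩
    have := hK ⟨e, rfl⟩
    rwa [div_le_iff₀ (sub_pos.2 he)] at this
  have hK0 : 0 ≤ K := by
    obtain ⟨r, hr⟩ := hRne
    rcases r.2.1.src_mem_or_eq with h | ⟨e, he, -⟩
    · exact absurd h N.origin_ne_dest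
    · have hSe := hR_mem.1 hr e he
      by_contra hc
      have := mul_nonpos_of_nonpos_of_nonneg (not_le.1 hc).le (sub_pos.2 hSe).le
      linarith [hK e hSe]
  set α : V → ℝ := fun z => K * β z + if z = v then 1 else 0 with hα
  have hind : ∀ z, (0 : ℝ) ≤ (if z = v then 1 else 0) ∧ (if z = v then (1 : ℝ) else 0) ≤ 1 :=
    fun z => by split_ifs <;> norm_num
  set a : E → Fin 2 → ℝ := fun e θ =>
    if S e then α (N.tgt e) - α (N.src e) else if θ = 0 then 2 else 0 with ha_def
  -- At the load `d * x e` the variable cost is `d` times the increment of β. This needs `x e > 0`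
  -- on all of `S`, hence the completed bridge.
  set b : E → ℝ := fun e => if S e then (β (N.tgt e) - β (N.src e)) / x e else 1 with hb_def
  have ha : ∀ e θ, 0 ≤ a e θ := by
    intro e θ
    by_cases he : S e
    · simp only [ha_def, he, if_true, hα]
      linarith [hK e he, (hind (N.tgt e)).1, (hind (N.src e)).2]
    · simp only [ha_def, he, if_false]
      split_ifs <;> norm_num
  have hb : ∀ e, 0 < b e := by
    intro e
    by_cases he : S e
    · simp only [hb_def, he, if_true]
      exact div_pos (sub_pos.2 he) (hxS e he)
    · simp [hb_def, he]
  have hk : 0 < k := Nat.pos_of_ne_zero fun hk => hw.ne (by rw [hk])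
  have hbridge : ∀ i < k, ∃ e, ¬ S e ∧ N.src e = w i ∧ N.tgt e = w (i + 1) := by
    intro i hi
    obtain ⟨e, -, h1, h2⟩ := hw.step i hi
    refine ⟨e, ?_, h1, h2⟩
    simp [hS, h1, h2, hw.level i hi.le, hw.level (i + 1) hi]
  have hne : ∃ e, a e 0 ≠ a e 1 := by
    obtain ⟨e, he, -⟩ := hbridge 0 hk
    exact ⟨e, by simp [ha_def, he]⟩
  refine ⟨a, b, ha, hb, hne, x, fun e => ?_, fun e he => ?_, ?_, ?_⟩
  · by_cases he : S e
    · exact (hxS e he).le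
    · exact (hx0 e he).ge
  · by_cases hSe : S e
    · simp [ha_def, hSe]
    · exact absurd (hx0 e hSe) he.ne'
  all_goals set G := affineGame N a b ha hb hne with hG
  -- the cost of the edges in `S` under the load `d * x`
  all_goals
    have hcost : ∀ d e, S e → ∀ θ, a e θ + b e * (d * x e) =
        (α (N.tgt e) + d * β (N.tgt e)) - (α (N.src e) + d * β (N.src e)) := by
      intro d e he θ
      have := (hxS e he).ne'
      simp only [ha_def, hb_def, he, if_true]
      field_simp
      ring
  · intro d hd
    set y : N.ODPath → ℝ := fun r => if r ∈ R then d / R.card else 0 with hy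
    have hload : ∀ e, G.load y e = d * x e := by
      intro e
      simp only [load, hy, hx, Finset.sum_ite, Finset.sum_const_zero, add_zero, Finset.sum_const,
        nsmul_eq_mul]
      have : ((Finset.univ.filter fun r : N.ODPath => e ∈ r.1).filter fun r => r ∈ R) =
          R.filter fun r => e ∈ r.1 := by
        ext r
        simp [and_comm]
      rw [this]
      ring
    have hfeas : G.IsFeasible d y := by
      refine ⟨fun r => ?_, ?_, fun e => ENNReal.ofReal_lt_top⟩
      · simp only [hy]
        split_ifs
        · exact div_nonneg hd hRc.le
        · exact le_rfl
      · simp only [hy, Finset.sum_ite_mem, Finset.univ_inter, Finset.sum_const, nsmul_eq_mul]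
        field_simp
    have hS_cost : ∀ e, S e → G.expectedCost G.prior e (G.load y e) =
        (α (N.tgt e) + d * β (N.tgt e)) - (α (N.src e) + d * β (N.src e)) := by
      intro e he
      rw [affineGame_expectedCost_prior, hload, ← hcost d e he 0]
      simp [ha_def, he]
    have hW : G.IsWardrop G.prior d y := by
      refine isWardrop_of_potential hfeas (fun z => α z + d * β z) (fun e => ?_) fun r hr e he => ?_
      · by_cases he : S e
        · exact (hS_cost e he).ge
        · rw [affineGame_expectedCost_prior, hload, hx0 e he]
          -- Outside `S` the increment of the potential is `K + d` times a nonpositive number, plus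
          -- at most 1 from the indicator; the expected cost at load zero is 1.
          have h1 : β (N.tgt e) - β (N.src e) ≤ 0 := sub_nonpos.2 (not_lt.1 he)
          have h2 := mul_nonpos_of_nonneg_of_nonpos (add_nonneg hK0 hd) h1
          have h3 : (a e 0 + a e 1) / 2 = 1 := by simp [ha_def, he]
          rw [h3]
          simp only [hα]
          linarith [(hind (N.tgt e)).2, (hind (N.src e)).1]
      · refine hS_cost e (hR_mem.1 ?_ e he)
        by_contra hc
        simp [hy, hc] at hr
    rw [hW.eqLoad_eq]
    exact funext hload
  · intro d hd hc
    -- An actual equilibrium is needed, so that `eqLoad` is not its default value `0`.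
    obtain ⟨y, hy⟩ := affineGame_exists_isWardrop (N := N) (ha := ha) (hb := hb) (hne := hne) 1
      hd.le
    rw [hy.eqLoad_eq] at hc
    have hload : ∀ e, G.load y e = d * x e := fun e => congrFun hc e
    have hS_cost : ∀ e, S e → G.expectedCost (Measure.dirac 1) e (G.load y e) =
        (α (N.tgt e) + d * β (N.tgt e)) - (α (N.src e) + d * β (N.src e)) := by
      intro e he
      rw [affineGame_expectedCost_dirac, hload, hcost d e he 1]
    have hfree : ∀ e, ¬ S e → G.expectedCost (Measure.dirac 1) e (G.load y e) = 0 := by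
      intro e he
      rw [affineGame_expectedCost_dirac, hload, hx0 e he]
      simp [ha_def, he]
    have hnn : ∀ e, 0 ≤ G.expectedCost (Measure.dirac 1) e (G.load y e) := by
      intro e
      rw [affineGame_expectedCost_dirac]
      exact add_nonneg (ha e 1) (mul_nonneg (hb e).le (load_nonneg hy.1.1 e))
    obtain ⟨r, hr⟩ : ∃ r, 0 < y r := by
      by_contra! hno
      have := hy.1.2.1
      rw [Finset.sum_eq_zero fun r _ => le_antisymm (hno r) (hy.1.1 r)] at this
      exact hd.ne this
    have hrS : ∀ e ∈ r.1, S e := by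
      intro e he
      by_contra hSe
      have h1 := le_load (G := G) hy.1.1 he
      rw [hload, hx0 e hSe, mul_zero] at h1
      linarith
    have hused := pathCost_eq_of_potential (G := G) (p := Measure.dirac 1) (y := y)
      (fun z => α z + d * β z) r fun e he => hS_cost e (hrS e he)
    obtain ⟨l₁, hl₁, hβ₁⟩ := ODGraph.exists_isWalk_of_reflTransGen_up hw.left_in
    obtain ⟨l₂, hl₂, hβ₂⟩ := ODGraph.exists_isWalk_of_seq hbridge
    obtain ⟨l₃, hl₃, hβ₃⟩ := ODGraph.exists_isWalk_of_reflTransGen_up hw.right_out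
    -- The walk through the bridge skips the increment 1 of the potential between `u` and `v`, so it
    -- is cheaper than a used path by exactly 1.
    have hle := hy.pathCost_le_walk hnn hr (hl₁.append (hl₂.append hl₃))
    have h1 := hl₁.sum_sub fun z => α z + d * β z
    have h3 := hl₃.sum_sub fun z => α z + d * β z
    rw [List.map_append, List.map_append, List.sum_append, List.sum_append,
      List.map_congr_left fun e he => hS_cost e (hβ₁ e he),
      List.map_congr_left fun e he => hS_cost e (hβ₃ e he),
      List.map_congr_left fun e he => hfree e (hβ₂ e he), h1, h3, hused] at hle
    have hu : u ≠ v := hw.ne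
    have hαuv : α v = α u + 1 := by simp [hα, hu, huv]
    have hzero : (List.map (fun _ : E => (0 : ℝ)) l₂).sum = 0 := by simp
    rw [hzero] at hle
    change _ ≤ (α u + d * β u - _) + (0 + (_ - (α v + d * β v))) at hle
    rw [hαuv, huv] at hle
    linarith

end RoutingGame

/-! ### Beliefs that never move, and failure of weak learning -/

/-- For a product measure, the second coordinate is independent of each σ-algebra of sets that are
almost everywhere equal to sets determined by the first coordinate. -/
theorem indep_comap_snd_of_le_eventuallyMeasurableSpace {α β : Type*} [mα : MeasurableSpace α]
    [mβ : MeasurableSpace β] (μ : Measure α) (ν : Measure β) [IsProbabilityMeasure μ]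
    [IsProbabilityMeasure ν] {m : MeasurableSpace (α × β)}
    (hm : m ≤ eventuallyMeasurableSpace (mα.comap Prod.fst) (ae (μ.prod ν))) :
    Indep (mβ.comap Prod.snd) m (μ.prod ν) := by
  rw [Indep_iff]
  rintro _ t ⟨s, hs, rfl⟩ ht
  obtain ⟨_, ⟨u, hu, rfl⟩, htu⟩ := hm t ht
  have h1 : (Prod.snd ⁻¹' s ∩ t : Set (α × β)) =ᵐ[μ.prod ν] 
      (Prod.snd ⁻¹' s ∩ Prod.fst ⁻¹' u : Set (α × β)) :=
    (ae_eq_refl _).inter htu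
  have h2 : (Prod.snd ⁻¹' s ∩ Prod.fst ⁻¹' u : Set (α × β)) = u ×ˢ s := by
    ext z
    simp [and_comm]
  have h3 : (Prod.snd ⁻¹' s : Set (α × β)) = Set.univ ×ˢ s := by
    ext z
    simp
  have h4 : (Prod.fst ⁻¹' u : Set (α × β)) = u ×ˢ Set.univ := by
    ext z
    simp
  rw [measure_congr h1, measure_congr htu, h2, h3, h4]
  simp [mul_comm]

namespace RoutingGame

variable {V E : Type*} {N : Network V E}
  {T : Type*} [MeasurableSpace T] (G : RoutingGame N T) (F : Measure ℝ) [IsProbabilityMeasure F]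

/-- An almost sure property of a single demand holds almost surely for the demand of a period. -/
theorem ae_demand {Q : ℝ → Prop} (hQ : ∀ᵐ d ∂F, Q d) (t : ℕ) : ∀ᵐ ω ∂G.law F, Q (ω.1 t) := by
  have h1 : ∀ᵐ η ∂Measure.infinitePi fun _ : ℕ => F, Q (η t) :=
    (measurePreserving_eval_infinitePi (fun _ : ℕ => F) t).quasiMeasurePreserving.ae hQ
  exact Measure.quasiMeasurePreserving_fst.ae h1

variable [Fintype T] [DiscreteMeasurableSpace T]

/-- Information that is essentially a function of the demands does not change the belief. -/
theorem condState_ae_eq_prior {m : MeasurableSpace G.Outcome}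
    (hm : m ≤ eventuallyMeasurableSpace (MeasurableSpace.comap Prod.fst inferInstance)
      (ae (G.law F))) : ∀ᵐ ω ∂G.law F, G.condState F m ω = G.prior := by
  have key : ∀ θ : T, ∀ᵐ ω ∂G.law F, (G.condState F m ω).real {θ} = G.prior.real {θ} := by
    intro θ
    have hms : MeasurableSet[Prod.instMeasurableSpace] (Prod.snd ⁻¹' {θ} : Set G.Outcome) :=
      measurable_snd (MeasurableSet.singleton θ)
    -- The conditional expectation kernel for `m` conditions on the intersection of `m` with the
    -- ambient σ-algebra.
    have hind := indep_comap_snd_of_le_eventuallyMeasurableSpace _ _ (inf_le_left.trans hm :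
      m ⊓ Prod.instMeasurableSpace ≤ _)
    have h1 := condExpKernel_ae_eq_condExp' (mΩ := Prod.instMeasurableSpace)
      (μ := G.law F) (m := m) hms
    have hsm : StronglyMeasurable[MeasurableSpace.comap Prod.snd inferInstance]
        ((Prod.snd ⁻¹' {θ} : Set G.Outcome).indicator fun _ => (1 : ℝ)) :=
      stronglyMeasurable_one.indicator ⟨{θ}, MeasurableSet.singleton θ, rfl⟩
    have h2 := condExp_indep_eq (m := Prod.instMeasurableSpace) (μ := G.law F)
      (m₁ := MeasurableSpace.comap Prod.snd inferInstance)
      (f := (Prod.snd ⁻¹' {θ} : Set G.Outcome).indicator fun _ => (1 : ℝ))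
      (@measurable_snd (ℕ → ℝ) T _ _).comap_le inf_le_right
      hsm hind
    filter_upwards [h1, h2] with ω hω1 hω2
    rw [condState, condLaw, map_measureReal_apply measurable_snd (MeasurableSet.singleton θ), hω1,
      hω2, integral_indicator_const _ hms]
    have : (Prod.snd ⁻¹' {θ} : Set G.Outcome) = Set.univ ×ˢ {θ} := by
      ext z
      simp
    rw [this, measureReal_prod_prod]
    simp
  filter_upwards [ae_all_iff.2 key] with ω hω
  have : IsFiniteMeasure (G.condState F m ω) := by
    rw [condState, condLaw]
    infer_instance
  refine Measure.ext_of_singleton fun θ => ?_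
  exact (measureReal_eq_measureReal_iff).1 (hω θ)

variable [Fintype E]

/-- If the observations that are made under the prior do not depend on the state, all beliefs are
equal to the prior. -/
theorem belief_ae_eq_prior {g : ℝ → E → ℝ × ℝ} (hg : Measurable g)
    (hobs : ∀ᵐ d ∂F, ∀ θ, G.observation (G.eqLoad G.prior d) θ = g d) (t : ℕ) :
    ∀ᵐ ω ∂G.law F, G.belief F t ω = G.prior := by
  set 𝓓 : MeasurableSpace G.Outcome := MeasurableSpace.comap Prod.fst inferInstance
  have hdem : ∀ t, Measurable[𝓓] fun ω : G.Outcome => ω.1 t := fun t =>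
    (measurable_pi_apply t).comp (comap_measurable _)
  have hle : 𝓓 ≤ eventuallyMeasurableSpace 𝓓 (ae (G.law F)) := le_eventuallyMeasurableSpace
  -- The belief equals the prior only almost surely, so the observations are functions of the
  -- demands up to null sets. Hence the induction works with the σ-algebra of the demands modulo
  -- null sets.
  have hhist : ∀ t, G.history F t ≤ eventuallyMeasurableSpace 𝓓 (ae (G.law F)) := by
    intro t
    induction t with
    | zero => exact (hdem 0).comap_le.trans hle
    | succ t ih =>
      refine sup_le (sup_le ih ?_) ((hdem (t + 1)).comap_le.trans hle)
      have hmeas : EventuallyMeasurable 𝓓 (ae (G.law F)) fun ω =>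
          G.observation (G.eqLoad (G.condState F (G.history F t) ω) (ω.1 t)) ω.2 := by
        refine (hg.comp (hdem t)).eventuallyMeasurable_of_eventuallyEq ?_
        filter_upwards [G.condState_ae_eq_prior F ih, G.ae_demand F hobs t] with ω h1 h2
        rw [h1, h2, Function.comp_apply]
      exact Measurable.comap_le hmeas
  exact G.condState_ae_eq_prior F (hhist t)

/-- If all beliefs are equal to the prior, weak learning fails for each positive demand at which a
state of positive prior probability has different loads. -/
theorem not_weakLearningOn {S : Set ℝ} (hbelief : ∀ t, ∀ᵐ ω ∂G.law F, G.belief F t ω = G.prior)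
    {θ : T} (hθ : G.prior {θ} ≠ 0) {d : ℝ} (hd : d ∈ S)
    (hne : G.eqLoad (Measure.dirac θ) d ≠ G.eqLoad G.prior d) : ¬ G.WeakLearningOn F S := by
  intro h
  have hae : ∀ᵐ ω ∂G.law F, ω.2 ≠ θ := by
    filter_upwards [h, ae_all_iff.2 hbelief] with ω h1 h2 hωθ
    refine hne ?_
    rw [← hωθ]
    refine (h1 G.prior ⟨inferInstance, fun θ' => ?_⟩ d hd).symm
    simp only [h2]
    exact tendsto_const_nhds
  have hset : {ω : G.Outcome | ¬ ω.2 ≠ θ} = Set.univ ×ˢ {θ} := by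
    ext ω
    simp
  rw [ae_iff, hset, Measure.prod_prod] at hae
  simp [hθ] at hae

end RoutingGame

theorem exists_pos_mem_support {F : Measure ℝ} [IsProbabilityMeasure F] (hF : ∀ᵐ d ∂F, 0 ≤ d)
    (hne : F ≠ Measure.dirac 0) : ∃ d ∈ F.support, 0 < d := by
  by_contra! hno
  refine hne ?_
  have h0 : ∀ᵐ d ∂F, d = 0 := by
    filter_upwards [hF, Measure.support_mem_ae (μ := F)] with d h1 h2
    exact le_antisymm (hno d h2) h1
  ext s hs
  by_cases h : (0 : ℝ) ∈ s
  · rw [Measure.dirac_apply_of_mem h, ← prob_compl_eq_zero_iff hs]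
    refine measure_mono_null (fun d hd => ?_) h0
    rintro rfl
    exact hd h
  · rw [Measure.dirac_apply' _ hs, Set.indicator_of_notMem h]
    refine measure_mono_null (fun d hd => ?_) h0
    rintro rfl
    exact h hd

theorem mainTheorem2 {V E : Type*} [Fintype V] [Fintype E] (N : Network V E)
    (hN : ¬ N.IsSeriesParallel) :
    ∃ (n : ℕ) (G : RoutingGame N (Fin n)), G.HasUnboundedCosts ∧
      ∀ (F : Measure ℝ) [IsProbabilityMeasure F],
        (∀ᵐ d ∂F, d ∈ Rco G.networkCapacity) →
          ¬ G.WeakLearning F ∧ (F ≠ Measure.dirac 0 → ¬ G.WeakLearningOnSupport F) := by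
  obtain ⟨a, b, ha, hb, hne, x, hx, hax, hprior, hgood⟩ :=
    RoutingGame.exists_affineGame N (N.isNet.isSPFrom_or_hasBridge.resolve_left hN)
  refine ⟨2, RoutingGame.affineGame N a b ha hb hne, RoutingGame.affineGame_hasUnboundedCosts,
    fun F _ hF => ?_⟩
  set G := RoutingGame.affineGame N a b ha hb hne
  have hcap : ∀ d, d ∈ Rco G.networkCapacity ↔ 0 ≤ d := by
    intro d
    rw [RoutingGame.affineGame_networkCapacity]
    exact ⟨fun h => h.1, fun h => ⟨h, ENNReal.ofReal_lt_top⟩⟩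
  simp only [hcap] at hF
  have hbelief := G.belief_ae_eq_prior F
    -- State 0 serves as reference: the edges with positive load have the same cost in both states.
    (g := fun d e => (d * x e, if 0 < d * x e then a e 0 + b e * (d * x e) else 0)) (by
      refine measurable_pi_lambda _ fun e => Measurable.prodMk (by fun_prop) ?_
      exact Measurable.ite (measurableSet_lt (by fun_prop) (by fun_prop)) (by fun_prop)
        (by fun_prop)) (by
      filter_upwards [hF] with d hd θ
      rw [hprior d hd]
      funext e
      simp only [RoutingGame.observation]
      split_ifs with h
      · have hxe : 0 < x e := pos_of_mul_pos_right h hd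
        refine Prod.ext rfl ?_
        change a e θ + _ = _
        fin_cases θ
        · rfl
        · exact congrArg (· + _) (hax e hxe).symm
      · rfl)
  have hpos : G.prior {1} ≠ 0 := by
    have : G.prior.real {1} = 1 / 2 := RoutingGame.affineGame_prior_real 1
    intro h
    simp [Measure.real, h] at this
  have hdiff : ∀ d, 0 < d → G.eqLoad (Measure.dirac 1) d ≠ G.eqLoad G.prior d := fun d hd => by
    rw [hprior d hd.le]
    exact hgood d hd
  -- All capacities are infinite, so the demand 1 is admissible whatever `F` is; any positive demand
  -- would do.
  refine ⟨G.not_weakLearningOn F hbelief hpos ((hcap 1).2 zero_le_one) (hdiff 1 one_pos),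
    fun hF0 => ?_⟩
  obtain ⟨d, hd, hd0⟩ := exists_pos_mem_support hF hF0
  exact G.not_weakLearningOn F hbelief hpos ⟨hd, (hcap d).2 hd0.le⟩ (hdiff d hd0)
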